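/- Let $\xi(t)=\beta^2\sum_{p\ge2}\beta_p^2t^p$ with $\beta\ne0$, not all $\beta_p$ ($p\ge 2$) equal to zero, and $\xi(1+\epsilon)<\infty$ for some $\epsilon>0$; let $h\ge0$. For a probability measure $\mu$ on $[0,1]$ let $\phi_\mu(t)=\int_t^1\mu([0,s])\,ds$ and $$P_{\xi,h}(\mu)=\frac12\left(\int_0^1\xi''\phi_\mu\,ds+\int_0^1\Big(\frac1{\phi_\mu}-\frac1{1-s}\Big)ds+h^2\phi_\mu(0)\right)\in[0,\infty].$$ Let $\mu$ be a minimizer of $P_{\xi,h}$ over the probability measures on $[0,1]$. Let $\mathfrak d=\big(1/\sqrt{\xi''}\big)''$ on $[0,1]$, with the convention $\mathfrak d(0)=+\infty$ if $\xi''(0)=0$. Then $\{t\in[0,1]:\mathfrak d(t)>0\}$ and $\{t\in[0,1]:\mathfrak d(t)\le0\}$ have finitely many connected components. The components of the former are nondegenerate intervals, with endpoints $a_i<b_i$ ($1\le i\le N_p$); the components of the latter are closed intervals $[a_i',b_i']$, $a_i'\le b_i'$ ($1\le i\le N_n$). There are points $q_{i_1},q_{i_2}\in[a_i,b_i]$ and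 $r_{i_1}\le r_{i_2}$ in $[a_i',b_i']$ and weights $m_{i_1},m_{i_2},n_{i_1},n_{i_2}\ge0$ such that $$\mu=\sum_{i=1}^{N_p}\big(m_{i_1}\delta_{q_{i_1}}+m_{i_2}\delta_{q_{i_2}}\big)+\sum_{i=1}^{N_n}\big(-\mathfrak d\,\mathbf 1_{[r_{i_1},r_{i_2}]}\,ds+n_{i_1}\delta_{r_{i_1}}+n_{i_2}\delta_{r_{i_2}}\big).$$ Moreover, $\mu\big([a_i,b_i]\setminus\{q_{i_1},q_{i_2}\}\big)=0$ for each $i\le N_p$, so that $\mu$ has at most two atoms and no other mass in the closure of a positive component; and for each $i\le N_n$ the restriction of $\mu$ to $[a_i',b_i']$ is the $i$-th term of the second sum. -/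

import Mathlib

open MeasureTheory Set
open scoped ENNReal NNReal

namespace CrisantiSommers

noncomputable section

/-- The mixed `p`-spin covariance `ξ(t) = β² ∑_{p ≥ 2} β_p² t^p` (the sum is shifted by two). -/
def xi (β : ℝ) (b : ℕ → ℝ) (t : ℝ) : ℝ :=
  β ^ 2 * ∑' p : ℕ, b (p + 2) ^ 2 * t ^ (p + 2)

/-- The probability measures on `[0,1]`, as measures on `ℝ` carried by `[0,1]`. -/
def Pr01 : Set (Measure ℝ) :=
  {μ | IsProbabilityMeasure μ ∧ μ (Icc (0 : ℝ) 1)ᶜ = 0}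

/-- `φ_μ(t) = ∫_t^1 μ([0,s]) ds`. -/
def phi (μ : Measure ℝ) (t : ℝ) : ℝ :=
  ∫ s in t..1, μ.real (Icc 0 s)

/-- The Crisanti–Sommers functional
`½ (∫₀¹ ξ'' φ_μ ds + ∫₀¹ (1/φ_μ - 1/(1-s)) ds + h² φ_μ(0))`.
For `μ` in `Pr01` and `ξ'' ≥ 0` on `[0,1]` one has `0 ≤ φ_μ(s) ≤ 1 - s`, so all three terms are
nonnegative, and the functional takes values in `[0,∞]`; here `1/0 = ∞`. -/
def functional (ξ : ℝ → ℝ) (h : ℝ) (μ : Measure ℝ) : ℝ≥0∞ :=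
  2⁻¹ * ((∫⁻ s in Ioo (0 : ℝ) 1, ENNReal.ofReal (iteratedDeriv 2 ξ s * phi μ s))
    + (∫⁻ s in Ioo (0 : ℝ) 1, ((ENNReal.ofReal (phi μ s))⁻¹ - (ENNReal.ofReal (1 - s))⁻¹))
    + ENNReal.ofReal (h ^ 2 * phi μ 0))

/-- `μ` minimizes the Crisanti–Sommers functional over the probability measures on `[0,1]`. -/
def IsOptimal (ξ : ℝ → ℝ) (h : ℝ) (μ : Measure ℝ) : Prop :=
  μ ∈ Pr01 ∧ IsMinOn (functional ξ h) Pr01 μ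

/-- `𝔡 = (1/√ξ'')''`. -/
def dfun (ξ : ℝ → ℝ) : ℝ → ℝ :=
  iteratedDeriv 2 (fun t => 1 / √(iteratedDeriv 2 ξ t))

/-- The set `{𝔡 > 0}` in `[0,1]`. A point with `ξ'' = 0` (only `0` can be one) is counted here:
`𝔡` tends to `+∞` at it. -/
def posSet (ξ : ℝ → ℝ) : Set ℝ :=
  {t ∈ Icc (0 : ℝ) 1 | iteratedDeriv 2 ξ t = 0 ∨ 0 < dfun ξ t}

/-- The set `{𝔡 ≤ 0}` in `[0,1]`, the complement of `posSet ξ` in `[0,1]`. -/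
def nonposSet (ξ : ℝ → ℝ) : Set ℝ :=
  {t ∈ Icc (0 : ℝ) 1 | iteratedDeriv 2 ξ t ≠ 0 ∧ dfun ξ t ≤ 0}

/-- `I` lists the connected components of `S`, each of them exactly once. -/
def EnumeratesComponents (S : Set ℝ) {N : ℕ} (I : Fin N → Set ℝ) : Prop :=
  Function.Injective I ∧ Set.range I = connectedComponentIn S '' S

/-- The measure `-𝔡 1_{[r₁,r₂]} ds + n₁ δ_{r₁} + n₂ δ_{r₂}`. -/
def nonposPart (ξ : ℝ → ℝ) (r₁ r₂ : ℝ) (n₁ n₂ : ℝ≥0) : Measure ℝ :=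
  (volume.restrict (Icc r₁ r₂)).withDensity (fun s => ENNReal.ofReal (-dfun ξ s))
    + n₁ • Measure.dirac r₁ + n₂ • Measure.dirac r₂

end

end CrisantiSommers

namespace CrisantiSommers

/-! Write `k = ξ'' - 1/φ_μ²` and `q = 1/√ξ''`. Fubini gives `φ_μ(t) = ∫ (1 - max z t) dμ(z)`, so the
first variation of the functional under moving mass from `z` to `y` is, up to the factor 1/2, `G(y)
- G(z)`, where `G'' = -k`, `G'(0) = -h²`. Optimality therefore forces `μ` to be carried by the
minimizers of `G` on `[0,1)` (`IsOptimal.measure_compl_minSet`). At a minimizer `G' = 0` and `k ≤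
0`. Moreover `k ≤ 0` means `φ_μ ≤ q`, and `k = 0` means `φ_μ = q`, so the problem becomes a
comparison of `q` with `φ_μ`, which is always concave and is affine on intervals that `μ` does not
charge.

Where `𝔡 = q'' > 0`, `q - φ_μ` is strictly convex and has at most two zeros. Three minimizers of `G`
would produce three zeros of `k` by applying Rolle twice, so there are at most two
(`IsOptimal.not_three_mem_minSet`).

Where `𝔡 ≤ 0`, consider a gap between two minimizers. There `φ_μ` is affine, so `q - φ_μ` is concave
and nonnegative at the ends, hence `k ≤ 0` and `G'` is nondecreasing. As `G'` vanishes at both ends,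
it vanishes on the gap (`IsOptimal.force_eq_zero_of_gap`). So `G' = 0` between the extreme
minimizers of the component, which gives `φ_μ = q` there; differentiating twice yields the density
`-𝔡`, and only the two end points can carry atoms.

Finiteness of the components holds because the sign of `𝔡` is that of `3 ξ'''² - 2 ξ'' ξ''''`, which
is analytic past `[0,1]`: it has finitely many zeros or vanishes identically. -/

/-! ### Power series: analyticity of `ξ` and positivity of `ξ''`. -/

/-- The terms at radius `R` are bounded, so `(n+1)(r/R)^n` dominates up to a constant. Iteration
covers higher derivatives. -/
theorem summable_succ_mul_pow {a : ℕ → ℝ} {R r : ℝ} (ha : Summable fun n => |a n| * R ^ n)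
    (hr : 0 ≤ r) (hrR : r < R) : Summable fun n : ℕ => |((n : ℝ) + 1) * a (n + 1)| * r ^ n := by
  have hR : 0 < R := hr.trans_lt hrR
  obtain ⟨C, hC⟩ := ha.tendsto_atTop_zero.bddAbove_range
  have hgeo : Summable fun n : ℕ => ((n : ℝ) + 1) * (r / R) ^ n := by
    have hlt : ‖r / R‖ < 1 := by
      rw [Real.norm_of_nonneg (by positivity), div_lt_one hR]; exact hrR
    have h1 := summable_pow_mul_geometric_of_norm_lt_one 1 hlt
    have h0 := summable_geometric_of_norm_lt_one hlt
    refine (h1.add h0).congr fun n => ?_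
    ring
  refine Summable.of_nonneg_of_le (fun n => by positivity) (fun n => ?_) (hgeo.mul_left (C / R))
  have hb : |a (n + 1)| * R ^ (n + 1) ≤ C := hC ⟨n + 1, rfl⟩
  rw [abs_mul, abs_of_nonneg (by positivity : (0 : ℝ) ≤ (n : ℝ) + 1), div_pow]
  have : |a (n + 1)| ≤ C / R ^ (n + 1) := by rwa [le_div_iff₀ (by positivity)]
  calc ((n : ℝ) + 1) * |a (n + 1)| * r ^ n ≤ ((n : ℝ) + 1) * (C / R ^ (n + 1)) * r ^ n := by gcongr
    _ = C / R * (((n : ℝ) + 1) * (r ^ n / R ^ n)) := by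
      rw [pow_succ]; field_simp

theorem hasDerivAt_tsum_mul_pow {a : ℕ → ℝ} {R t : ℝ} (ha : Summable fun n => |a n| * R ^ n)
    (ht : |t| < R) : HasDerivAt (fun x => ∑' n, a n * x ^ n)
      (∑' n : ℕ, (((n : ℝ) + 1) * a (n + 1)) * t ^ n) t := by
  obtain ⟨r, htr, hrR⟩ := exists_between ht
  have hr : 0 < r := (abs_nonneg t).trans_lt htr
  have hs := summable_succ_mul_pow ha hr.le hrR
  have hu : Summable fun n : ℕ => |(n : ℝ) * a n| * r ^ (n - 1) := by
    rw [← summable_nat_add_iff 1]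
    refine hs.congr fun n => ?_
    simp
  have key := hasDerivAt_tsum_of_isPreconnected (g := fun n x => a n * x ^ n)
    (g' := fun n x => a n * ((n : ℝ) * x ^ (n - 1))) (t := Ioo (-r) r) (y₀ := 0) (y := t)
    hu isOpen_Ioo isPreconnected_Ioo (fun n y _ => (hasDerivAt_pow n y).const_mul (a n))
    (fun n y hy => ?_) ⟨by linarith, hr⟩ ?_ (abs_lt.1 htr)
  · have hsum : Summable fun n : ℕ => a n * ((n : ℝ) * t ^ (n - 1)) := by
      refine Summable.of_norm_bounded hu fun n => ?_
      rw [Real.norm_eq_abs, ← mul_assoc, abs_mul, abs_pow, mul_comm (a n)]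
      gcongr
    -- The exponent `n - 1` is truncated at `n = 0`, but that term carries the factor `0`; removing
    -- it shifts the index.
    rw [hsum.tsum_eq_zero_add] at key
    simp only [Nat.cast_zero, zero_mul, mul_zero, zero_add] at key
    refine key.congr_deriv (tsum_congr fun n => ?_)
    simp only [Nat.cast_add, Nat.cast_one, Nat.add_sub_cancel]
    ring
  · rw [Real.norm_eq_abs, ← mul_assoc, abs_mul, abs_pow, mul_comm (a n)]
    gcongr
    exact (abs_lt.2 hy).le
  · refine summable_of_ne_finset_zero (s := {0}) fun n hn => ?_
    have : n ≠ 0 := by simpa using hn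
    simp [this]

theorem analyticOnNhd_tsum_mul_pow {a : ℕ → ℝ} {R : ℝ} (hR : 0 < R)
    (ha : Summable fun n => |a n| * R ^ n) :
    AnalyticOnNhd ℝ (fun x => ∑' n, a n * x ^ n) (Ioo (-R) R) := by
  have hrad : ENNReal.ofReal R ≤ (FormalMultilinearSeries.ofScalars ℝ a).radius := by
    refine FormalMultilinearSeries.le_radius_of_summable_norm _ (r := R.toNNReal) ?_
    refine ha.congr fun n => ?_
    rw [Real.coe_toNNReal _ hR.le]
    simp
  have hball := (FormalMultilinearSeries.ofScalars ℝ a).hasFPowerSeriesOnBall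
    (lt_of_lt_of_le (by simpa using hR) hrad)
  have han := (hball.mono (by simpa using hR) hrad).analyticOnNhd
  have heq : (FormalMultilinearSeries.ofScalars ℝ a).sum = fun x => ∑' n, a n * x ^ n := by
    ext x
    rw [← FormalMultilinearSeries.ofScalarsSum, FormalMultilinearSeries.ofScalarsSum_eq_tsum]
    simp
  rw [heq] at han
  refine han.mono fun x hx => ?_
  rw [← Real.ball_zero_eq_Ioo] at hx
  rwa [Metric.eball_ofReal]

/-- The coefficients of `xi` as an ordinary power series. -/
def xiCoeff (β : ℝ) (b : ℕ → ℝ) (n : ℕ) : ℝ :=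
  if n < 2 then 0 else β ^ 2 * b n ^ 2

theorem xiCoeff_nonneg (β : ℝ) (b : ℕ → ℝ) (n : ℕ) : 0 ≤ xiCoeff β b n := by
  unfold xiCoeff; split_ifs <;> positivity

theorem xiCoeff_summable (β : ℝ) {b : ℕ → ℝ} {R : ℝ}
    (hs : Summable (fun p : ℕ => b (p + 2) ^ 2 * R ^ (p + 2))) :
    Summable fun n => |xiCoeff β b n| * R ^ n := by
  rw [← summable_nat_add_iff 2]
  refine (hs.mul_left (β ^ 2)).congr fun n => ?_
  rw [abs_of_nonneg (xiCoeff_nonneg _ _ _)]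
  simp [xiCoeff, mul_assoc]

theorem xi_eq_tsum (β : ℝ) {b : ℕ → ℝ} {R t : ℝ}
    (hs : Summable (fun p : ℕ => b (p + 2) ^ 2 * R ^ (p + 2))) (ht : |t| ≤ R) :
    xi β b t = ∑' n, xiCoeff β b n * t ^ n := by
  have hsum : Summable fun n => xiCoeff β b n * t ^ n := by
    refine Summable.of_norm_bounded (xiCoeff_summable β hs) fun n => ?_
    rw [Real.norm_eq_abs, abs_mul, abs_pow]
    gcongr
  rw [← hsum.sum_add_tsum_nat_add 2, xi, ← tsum_mul_left]
  simp [Finset.sum_range_succ, xiCoeff, mul_assoc]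

theorem eventuallyEq_xi_tsum (β : ℝ) {b : ℕ → ℝ} {R t : ℝ}
    (hs : Summable (fun p : ℕ => b (p + 2) ^ 2 * R ^ (p + 2))) (ht : |t| < R) :
    xi β b =ᶠ[nhds t] fun x => ∑' n, xiCoeff β b n * x ^ n := by
  have : Ioo (-R) R ∈ nhds t := isOpen_Ioo.mem_nhds (abs_lt.1 ht)
  filter_upwards [this] with x hx using xi_eq_tsum β hs (abs_lt.2 hx).le

theorem xi_analyticOnNhd (β : ℝ) {b : ℕ → ℝ} {R : ℝ} (hR : 0 < R)
    (hs : Summable (fun p : ℕ => b (p + 2) ^ 2 * R ^ (p + 2))) :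
    AnalyticOnNhd ℝ (xi β b) (Ioo (-R) R) := fun t ht =>
  (analyticOnNhd_tsum_mul_pow hR (xiCoeff_summable β hs) t ht).congr
    (eventuallyEq_xi_tsum β hs (abs_lt.2 ht)).symm

theorem iteratedDeriv_two_xi (β : ℝ) {b : ℕ → ℝ} {R t : ℝ}
    (hs : Summable (fun p : ℕ => b (p + 2) ^ 2 * R ^ (p + 2))) (ht : |t| < R) :
    iteratedDeriv 2 (xi β b) t =
      ∑' n : ℕ, (((n : ℝ) + 1) * (((n + 1 : ℕ) : ℝ) + 1) * xiCoeff β b (n + 2)) * t ^ n := by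
  obtain ⟨r, htr, hrR⟩ := exists_between ht
  have hr : 0 < r := (abs_nonneg t).trans_lt htr
  have h1 := xiCoeff_summable β hs
  have h2 := summable_succ_mul_pow h1 hr.le hrR
  have hd : deriv (xi β b) =ᶠ[nhds t]
      fun x => ∑' n : ℕ, (((n : ℝ) + 1) * xiCoeff β b (n + 1)) * x ^ n := by
    filter_upwards [isOpen_Ioo.mem_nhds (abs_lt.1 ht)] with x hx
    rw [(eventuallyEq_xi_tsum β hs (abs_lt.2 hx)).deriv_eq]
    exact (hasDerivAt_tsum_mul_pow h1 (abs_lt.2 hx)).deriv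
  rw [iteratedDeriv_succ, iteratedDeriv_one, hd.deriv_eq, (hasDerivAt_tsum_mul_pow h2 htr).deriv]
  refine tsum_congr fun n => ?_
  ring

/-- The coefficients are nonnegative and one is positive. The point `0` is excluded because `ξ''(0)
= 0` when `b 2 = 0`. -/
theorem iteratedDeriv_two_xi_pos {β : ℝ} {b : ℕ → ℝ} {R t : ℝ} (hβ : β ≠ 0)
    (hb : ∃ p : ℕ, 2 ≤ p ∧ b p ≠ 0)
    (hs : Summable (fun p : ℕ => b (p + 2) ^ 2 * R ^ (p + 2))) (ht0 : 0 < t) (ht : t < R) :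
    0 < iteratedDeriv 2 (xi β b) t := by
  have ht' : |t| < R := by rwa [abs_of_pos ht0]
  rw [iteratedDeriv_two_xi β hs ht']
  obtain ⟨r, htr, hrR⟩ := exists_between ht
  have hr : 0 < r := ht0.trans htr
  have h2 := summable_succ_mul_pow (xiCoeff_summable β hs) hr.le hrR
  have h3 := summable_succ_mul_pow h2 ht0.le htr
  have hnn : ∀ n : ℕ, 0 ≤ (((n : ℝ) + 1) * (((n + 1 : ℕ) : ℝ) + 1) * xiCoeff β b (n + 2)) * t ^ n :=
    fun n => by have := xiCoeff_nonneg β b (n + 2); positivity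
  obtain ⟨p, hp, hbp⟩ := hb
  obtain ⟨n, rfl⟩ := Nat.exists_eq_add_of_le' hp
  refine Summable.tsum_pos (h3.congr fun m => ?_) hnn n ?_
  · have := xiCoeff_nonneg β b (m + 2)
    rw [abs_of_nonneg (by positivity)]
    ring
  · have : 0 < xiCoeff β b (n + 2) := by
      simp only [xiCoeff]
      rw [if_neg (by omega)]
      positivity
    positivity

/-! ### Monotonicity, concavity and integral representation of `φ_μ`. -/

section Phi

variable {μ : Measure ℝ}

theorem monotone_measureReal_Icc [IsFiniteMeasure μ] : Monotone fun s => μ.real (Icc 0 s) :=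
  fun _ _ h => measureReal_mono (Icc_subset_Icc_right h)

theorem intervalIntegrable_measureReal_Icc [IsFiniteMeasure μ] (a b : ℝ) :
    IntervalIntegrable (fun s => μ.real (Icc 0 s)) volume a b :=
  monotone_measureReal_Icc.intervalIntegrable

theorem phi_sub_phi [IsFiniteMeasure μ] (s t : ℝ) :
    phi μ s - phi μ t = ∫ x in s..t, μ.real (Icc 0 x) := by
  have := intervalIntegral.integral_add_adjacent_intervals
    (intervalIntegrable_measureReal_Icc (μ := μ) s t)
    (intervalIntegrable_measureReal_Icc (μ := μ) t 1)
  simp only [phi]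
  linarith

theorem phi_one : phi μ 1 = 0 := by simp [phi]

theorem antitone_phi [IsFiniteMeasure μ] : Antitone (phi μ) := fun s t hst => by
  have h : 0 ≤ ∫ x in s..t, μ.real (Icc 0 x) :=
    intervalIntegral.integral_nonneg hst fun _ _ => measureReal_nonneg
  have := phi_sub_phi (μ := μ) s t
  linarith

theorem phi_nonneg [IsFiniteMeasure μ] {t : ℝ} (ht : t ≤ 1) : 0 ≤ phi μ t := by
  simpa [phi_one] using antitone_phi (μ := μ) ht

theorem continuous_phi [IsFiniteMeasure μ] : Continuous (phi μ) := by
  have h : phi μ = fun t => -∫ s in (1 : ℝ)..t, μ.real (Icc 0 s) := by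
    ext t; rw [phi, intervalIntegral.integral_symm]
  rw [h]
  exact (intervalIntegral.continuous_primitive
    (fun a b => intervalIntegrable_measureReal_Icc a b) 1).neg

/-- Since `s ↦ μ([0,s])` is monotone, the slope of `-φ_μ` on `[s,t]` lies between its end values.
This bound and the next give concavity, and recover `μ([0,s])` from a derivative of `φ_μ`. -/
theorem measureReal_Icc_mul_le_phi_sub [IsFiniteMeasure μ] {s t : ℝ} (hst : s ≤ t) :
    μ.real (Icc 0 s) * (t - s) ≤ phi μ s - phi μ t := by
  rw [phi_sub_phi]
  have := intervalIntegral.integral_mono_on hst (intervalIntegrable_const)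
    (intervalIntegrable_measureReal_Icc (μ := μ) s t)
    (fun x hx => monotone_measureReal_Icc hx.1)
  rw [intervalIntegral.integral_const, smul_eq_mul] at this
  rw [mul_comm]
  exact this

theorem phi_sub_le_measureReal_Icc_mul [IsFiniteMeasure μ] {s t : ℝ} (hst : s ≤ t) :
    phi μ s - phi μ t ≤ μ.real (Icc 0 t) * (t - s) := by
  rw [phi_sub_phi]
  have := intervalIntegral.integral_mono_on hst
    (intervalIntegrable_measureReal_Icc (μ := μ) s t) (intervalIntegrable_const)
    (fun x hx => monotone_measureReal_Icc hx.2)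
  rw [intervalIntegral.integral_const, smul_eq_mul] at this
  rw [mul_comm]
  exact this

theorem phi_le_of_measureReal_le [IsFiniteMeasure μ] {c t : ℝ} (ht : t ≤ 1)
    (hc : ∀ s < 1, μ.real (Icc 0 s) ≤ c) : phi μ t ≤ c * (1 - t) := by
  have := intervalIntegral.integral_mono_on_of_le_Ioo ht
    (intervalIntegrable_measureReal_Icc (μ := μ) t 1) (intervalIntegrable_const)
    (fun x hx => hc x hx.2)
  rw [intervalIntegral.integral_const, smul_eq_mul] at this
  rw [mul_comm]
  exact this

theorem phi_le_one_sub [IsProbabilityMeasure μ] {t : ℝ} (ht : t ≤ 1) : phi μ t ≤ 1 - t := by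
  simpa using phi_le_of_measureReal_le (μ := μ) ht fun _ _ => measureReal_le_one

theorem concaveOn_phi [IsFiniteMeasure μ] : ConcaveOn ℝ univ (phi μ) := by
  refine concaveOn_of_slope_anti_adjacent convex_univ fun {x y z} _ _ hxy hyz => ?_
  have h1 := phi_sub_le_measureReal_Icc_mul (μ := μ) hxy.le
  have h2 := measureReal_Icc_mul_le_phi_sub (μ := μ) hyz.le
  have hxy' := sub_pos.2 hxy
  have hyz' := sub_pos.2 hyz
  calc (phi μ z - phi μ y) / (z - y) ≤ -μ.real (Icc 0 y) := by
        rw [div_le_iff₀ hyz']; linarith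
    _ ≤ (phi μ y - phi μ x) / (y - x) := by
        rw [le_div_iff₀ hxy']; linarith

/-- Fubini for the indicator of `z ≤ s`. The formula is linear in `μ`, so the effect of moving mass
on `φ_μ` can be read off. -/
theorem phi_eq_integral_max [IsFiniteMeasure μ] (hμ : μ (Icc (0 : ℝ) 1)ᶜ = 0) {t : ℝ}
    (ht1 : t ≤ 1) : phi μ t = ∫ z, (1 - max z t) ∂μ := by
  have hae : ∀ᵐ z ∂μ, z ∈ Icc (0 : ℝ) 1 := by
    rw [ae_iff]; exact hμ
  have hmeas : MeasurableSet {p : ℝ × ℝ | p.2 ≤ p.1} := measurableSet_le measurable_snd measurable_fst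
  have hleft : ∀ s ∈ Ioc t 1,
      μ.real (Icc 0 s) = ∫ z, {p : ℝ × ℝ | p.2 ≤ p.1}.indicator (fun _ => (1 : ℝ)) (s, z) ∂μ := by
    intro s hs
    have h1 : (fun z => {p : ℝ × ℝ | p.2 ≤ p.1}.indicator (fun _ => (1 : ℝ)) (s, z))
        = (Iic s).indicator 1 := by
      ext z; simp [indicator_apply]
    rw [h1, integral_indicator_one measurableSet_Iic]
    refine measureReal_congr ?_
    filter_upwards [hae] with z hz
    exact propext ⟨fun h => h.2, fun h => ⟨hz.1, h⟩⟩
  have hright : ∀ z ∈ Icc (0 : ℝ) 1,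
      ∫ s in Ioc t 1, {p : ℝ × ℝ | p.2 ≤ p.1}.indicator (fun _ => (1 : ℝ)) (s, z) = 1 - max z t := by
    intro z hz
    have h1 : (fun s => {p : ℝ × ℝ | p.2 ≤ p.1}.indicator (fun _ => (1 : ℝ)) (s, z))
        = (Ici z).indicator 1 := by
      ext z; simp [indicator_apply]
    rw [h1, integral_indicator_one measurableSet_Ici, measureReal_restrict_apply measurableSet_Ici]
    rcases le_or_gt z t with h | h
    · have : Ici z ∩ Ioc t 1 = Ioc t 1 := by
        ext x; simp only [mem_inter_iff, mem_Ici, mem_Ioc]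
        exact ⟨fun h => h.2, fun h' => ⟨by linarith [h'.1], h'⟩⟩
      rw [this, max_eq_right h, Real.volume_real_Ioc_of_le ht1]
    · have : Ici z ∩ Ioc t 1 = Icc z 1 := by
        ext x; simp only [mem_inter_iff, mem_Ici, mem_Ioc, mem_Icc]
        exact ⟨fun h => ⟨h.1, h.2.2⟩, fun h' => ⟨h'.1, by linarith [h'.1], h'.2⟩⟩
      rw [this, max_eq_left h.le, Real.volume_real_Icc_of_le hz.2]
  rw [phi, intervalIntegral.integral_of_le ht1, setIntegral_congr_fun measurableSet_Ioc hleft]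
  rw [integral_integral_swap]
  · exact integral_congr_ae (by filter_upwards [hae] with z hz using hright z hz)
  · exact (integrable_const (1 : ℝ)).indicator hmeas

theorem phi_dirac_zero {t : ℝ} (ht : t ∈ Icc (0 : ℝ) 1) : phi (Measure.dirac 0) t = 1 - t := by
  rw [phi_eq_integral_max (by simp) ht.2, integral_dirac]
  simp [ht.1]

end Phi

/-! ### Consequences of a finite value of the functional. -/

theorem dirac_mem_Pr01 {y : ℝ} (hy : y ∈ Icc (0 : ℝ) 1) : Measure.dirac y ∈ Pr01 :=
  ⟨inferInstance, by
    rw [Measure.dirac_apply' _ measurableSet_Icc.compl]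
    simpa using hy⟩

variable {ξ : ℝ → ℝ} {h : ℝ} {μ ν : Measure ℝ}

theorem functional_dirac_zero_lt_top (hf : ContinuousOn (iteratedDeriv 2 ξ) (Icc (-1) 1)) :
    functional ξ h (Measure.dirac 0) < ∞ := by
  have h2 : (∫⁻ s in Ioo (0 : ℝ) 1, ((ENNReal.ofReal (phi (Measure.dirac 0) s))⁻¹
      - (ENNReal.ofReal (1 - s))⁻¹)) = 0 := by
    rw [setLIntegral_congr_fun (g := fun _ => 0) measurableSet_Ioo]
    · simp
    · intro s hs
      simp only
      rw [phi_dirac_zero ⟨hs.1.le, hs.2.le⟩, tsub_self]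
  have h1 : (∫⁻ s in Ioo (0 : ℝ) 1,
      ENNReal.ofReal (iteratedDeriv 2 ξ s * phi (Measure.dirac 0) s)) < ∞ := by
    have : IntegrableOn (fun s => iteratedDeriv 2 ξ s * phi (Measure.dirac 0) s) (Icc 0 1) :=
      ((hf.mono (Icc_subset_Icc_left (by norm_num))).mul
        continuous_phi.continuousOn).integrableOn_Icc
    exact (this.mono_set Ioo_subset_Icc_self).lintegral_lt_top
  rw [functional, h2]
  refine ENNReal.mul_lt_top (by simp) ?_
  simp [h1]

theorem IsOptimal.functional_lt_top (hμ : IsOptimal ξ h μ)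
    (hf : ContinuousOn (iteratedDeriv 2 ξ) (Icc (-1) 1)) : functional ξ h μ < ∞ :=
  (hμ.2 (dirac_mem_Pr01 ⟨le_rfl, zero_le_one⟩)).trans_lt (functional_dirac_zero_lt_top hf)

theorem lintegral_inv_phi_lt_top (hfin : functional ξ h μ < ∞) :
    (∫⁻ s in Ioo (0 : ℝ) 1, ((ENNReal.ofReal (phi μ s))⁻¹ - (ENNReal.ofReal (1 - s))⁻¹)) < ∞ := by
  rw [functional] at hfin
  have h1 := ENNReal.lt_top_of_mul_ne_top_right hfin.ne (by simp)
  exact (ENNReal.add_lt_top.1 (ENNReal.add_lt_top.1 h1).1).2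

/-- `φ_μ` is nonnegative and nonincreasing on `[0,1]`, so a zero before `1` persists up to `1` and
makes `1/φ_μ` infinite on a set of positive length. -/
theorem phi_pos_of_functional_lt_top [IsProbabilityMeasure μ] (hfin : functional ξ h μ < ∞)
    {t : ℝ} (ht : t < 1) : 0 < phi μ t := by
  by_contra hcon
  have hzero : ∀ s, t ≤ s → s ≤ 1 → phi μ s = 0 := fun s h1 h2 =>
    le_antisymm ((antitone_phi h1).trans (not_lt.1 hcon)) (phi_nonneg h2)
  have hlt := lintegral_inv_phi_lt_top hfin
  refine hlt.ne (top_le_iff.1 ?_)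
  have hm : max t 0 < 1 := max_lt ht one_pos
  calc (∞ : ℝ≥0∞) = ∫⁻ s in Ioo (max t 0) 1, ∞ := by
        rw [setLIntegral_const, ENNReal.top_mul]
        simpa using hm
    _ = ∫⁻ s in Ioo (max t 0) 1,
          ((ENNReal.ofReal (phi μ s))⁻¹ - (ENNReal.ofReal (1 - s))⁻¹) := by
        refine setLIntegral_congr_fun measurableSet_Ioo fun s hs => ?_
        rw [hzero s ((le_max_left _ _).trans hs.1.le) hs.2.le, ENNReal.ofReal_zero,
          ENNReal.inv_zero, ENNReal.top_sub]
        simpa using hs.2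
    _ ≤ _ := lintegral_mono_set (Ioo_subset_Ioo_left (le_max_right _ _))

/-- An atom of mass `a` at `1` gives `φ_μ(t) ≤ (1-a)(1-t)`, so the second integrand is at least a
positive multiple of `1/(1-s)`, which is not integrable. -/
theorem measure_singleton_one_of_functional_lt_top [IsProbabilityMeasure μ]
    (hfin : functional ξ h μ < ∞) : μ {1} = 0 := by
  by_contra hne
  set a := μ.real {1} with ha
  have ha0 : 0 < a := ENNReal.toReal_pos hne (measure_ne_top _ _)
  have hle : ∀ s < 1, μ.real (Icc 0 s) ≤ 1 - a := by
    intro s hs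
    have hd : Disjoint (Icc 0 s) {(1 : ℝ)} := by
      rw [disjoint_singleton_right]; exact fun h => absurd h.2 (not_le.2 hs)
    have h1 := measureReal_union (μ := μ) hd (measurableSet_singleton 1)
    have h2 : μ.real (Icc 0 s ∪ {1}) ≤ 1 := measureReal_le_one
    linarith
  have hphi : ∀ t ≤ 1, phi μ t ≤ (1 - a) * (1 - t) := fun t ht => phi_le_of_measureReal_le ht hle
  have ha1 : a < 1 := by
    have := phi_pos_of_functional_lt_top hfin one_half_lt_one
    have h2 := hphi (1 / 2) (by norm_num)
    by_contra hcon
    nlinarith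
  have hc : 0 < 1 / (1 - a) - 1 := by
    rw [sub_pos, lt_div_iff₀ (by linarith)]; linarith
  set c := 1 / (1 - a) - 1 with hcdef
  have hlt := lintegral_inv_phi_lt_top hfin
  have hint : IntegrableOn (fun s : ℝ => c * (1 - s)⁻¹) (Ioo 0 1) := by
    refine ⟨(by fun_prop : Measurable fun s : ℝ => c * (1 - s)⁻¹).aestronglyMeasurable, ?_⟩
    rw [hasFiniteIntegral_iff_ofReal]
    · refine lt_of_le_of_lt (setLIntegral_mono' measurableSet_Ioo fun s hs => ?_) hlt
      have hs1 : 0 < 1 - s := by linarith [hs.2]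
      have hp := phi_pos_of_functional_lt_top hfin hs.2
      rw [← ENNReal.ofReal_inv_of_pos hp, ← ENNReal.ofReal_inv_of_pos hs1,
        ← ENNReal.ofReal_sub _ (by positivity)]
      refine ENNReal.ofReal_le_ofReal ?_
      have := inv_anti₀ hp (hphi s hs.2.le)
      rw [mul_inv] at this
      rw [hcdef, sub_mul, one_div]
      linarith
    · filter_upwards [ae_restrict_mem measurableSet_Ioo] with s hs
      have hs1 : 0 < 1 - s := by linarith [hs.2]
      simp only [Pi.zero_apply]
      positivity
  have hint2 : IntervalIntegrable (fun s : ℝ => (s - 1)⁻¹) volume 0 1 := by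
    rw [intervalIntegrable_iff_integrableOn_Ioo_of_le zero_le_one]
    refine (Integrable.const_mul hint (-c⁻¹)).congr (ae_of_all _ fun s => ?_)
    simp only
    rw [← neg_sub s 1, inv_neg]
    field_simp
  rw [intervalIntegrable_sub_inv_iff] at hint2
  rcases hint2 with h | h
  · norm_num at h
  · exact h (by simp)

/-! ### Localization to `[0,c]` and the first variation. -/

/-- The part of the functional that sees only `[0,c]`. -/
noncomputable def headFunctional (ξ : ℝ → ℝ) (h c : ℝ) (μ : Measure ℝ) : ℝ :=
  (∫ s in (0 : ℝ)..c, (iteratedDeriv 2 ξ s * phi μ s + ((phi μ s)⁻¹ - (1 - s)⁻¹)))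
    + h ^ 2 * phi μ 0

/-- `φ_μ` vanishes at `1`, so `1/φ_μ` is tame only away from `1`. On `[0,c]` everything is a real
integral of a continuous function; the rest stays in `[0,∞]` and cancels in comparisons. -/
theorem functional_eq_head_add_tail [IsProbabilityMeasure μ]
    (hf : ContinuousOn (iteratedDeriv 2 ξ) (Icc (-1) 1))
    (hpos : ∀ t ∈ Icc (0 : ℝ) 1, 0 ≤ iteratedDeriv 2 ξ t) {c : ℝ} (hc0 : 0 < c) (hc1 : c < 1)
    (hphi : 0 < phi μ c) :
    functional ξ h μ = 2⁻¹ * (ENNReal.ofReal (headFunctional ξ h c μ) +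
      ((∫⁻ s in Ico c 1, ENNReal.ofReal (iteratedDeriv 2 ξ s * phi μ s)) +
        ∫⁻ s in Ico c 1, ((ENNReal.ofReal (phi μ s))⁻¹ - (ENNReal.ofReal (1 - s))⁻¹))) := by
  have hsplit : Ioo (0 : ℝ) 1 = Ioo 0 c ∪ Ico c 1 := (Ioo_union_Ico_eq_Ioo hc0 hc1.le).symm
  have hdisj : Disjoint (Ioo (0 : ℝ) c) (Ico c 1) :=
    disjoint_left.2 fun x hx hx' => absurd hx.2 (not_lt.2 hx'.1)
  have hlin : ∀ F : ℝ → ℝ≥0∞, ∫⁻ s in Ioo (0 : ℝ) 1, F s =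
      (∫⁻ s in Ioo 0 c, F s) + ∫⁻ s in Ico c 1, F s := fun F => by
    rw [hsplit, lintegral_union measurableSet_Ico hdisj]
  have hphipos : ∀ s ≤ c, 0 < phi μ s := fun s hs => hphi.trans_le (antitone_phi hs)
  have hsub : Icc 0 c ⊆ Icc (-1 : ℝ) 1 := Icc_subset_Icc (by norm_num) hc1.le
  have hc1' : ContinuousOn (fun s => iteratedDeriv 2 ξ s * phi μ s) (Icc 0 c) :=
    (hf.mono hsub).mul continuous_phi.continuousOn
  have hc2' : ContinuousOn (fun s => (phi μ s)⁻¹ - (1 - s)⁻¹) (Icc 0 c) :=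
    (continuous_phi.continuousOn.inv₀ fun s hs => (hphipos s hs.2).ne').sub
      ((by fun_prop : Continuous fun s : ℝ => 1 - s).continuousOn.inv₀
        fun s hs => by linarith [hs.2])
  have hi1 := hc1'.integrableOn_Icc.mono_set Ioo_subset_Icc_self (μ := volume)
  have hi2 := hc2'.integrableOn_Icc.mono_set Ioo_subset_Icc_self (μ := volume)
  have hn1 : ∀ s ∈ Icc 0 c, 0 ≤ iteratedDeriv 2 ξ s * phi μ s := fun s hs =>
    mul_nonneg (hpos s ⟨hs.1, hs.2.trans hc1.le⟩) (hphipos s hs.2).le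
  have hn2 : ∀ s ∈ Icc 0 c, 0 ≤ (phi μ s)⁻¹ - (1 - s)⁻¹ := fun s hs =>
    sub_nonneg.2 (inv_anti₀ (hphipos s hs.2) (phi_le_one_sub (hs.2.trans hc1.le)))
  have h1 : (∫⁻ s in Ioo 0 c, ENNReal.ofReal (iteratedDeriv 2 ξ s * phi μ s))
      = ENNReal.ofReal (∫ s in (0 : ℝ)..c, iteratedDeriv 2 ξ s * phi μ s) := by
    rw [intervalIntegral.integral_of_le hc0.le, integral_Ioc_eq_integral_Ioo,
      ofReal_integral_eq_lintegral_ofReal hi1]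
    filter_upwards [ae_restrict_mem measurableSet_Ioo] with s hs
    exact hn1 s (Ioo_subset_Icc_self hs)
  have h2 : (∫⁻ s in Ioo 0 c, ((ENNReal.ofReal (phi μ s))⁻¹ - (ENNReal.ofReal (1 - s))⁻¹))
      = ENNReal.ofReal (∫ s in (0 : ℝ)..c, ((phi μ s)⁻¹ - (1 - s)⁻¹)) := by
    rw [intervalIntegral.integral_of_le hc0.le, integral_Ioc_eq_integral_Ioo,
      ofReal_integral_eq_lintegral_ofReal hi2]
    · refine setLIntegral_congr_fun measurableSet_Ioo fun s hs => ?_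
      have hs1 : 0 < 1 - s := by linarith [hs.2]
      rw [← ENNReal.ofReal_inv_of_pos (hphipos s hs.2.le), ← ENNReal.ofReal_inv_of_pos hs1,
        ← ENNReal.ofReal_sub _ (by positivity)]
    · filter_upwards [ae_restrict_mem measurableSet_Ioo] with s hs
      exact hn2 s (Ioo_subset_Icc_self hs)
  have hI1 : 0 ≤ ∫ s in (0 : ℝ)..c, iteratedDeriv 2 ξ s * phi μ s :=
    intervalIntegral.integral_nonneg hc0.le hn1
  have hI2 : 0 ≤ ∫ s in (0 : ℝ)..c, ((phi μ s)⁻¹ - (1 - s)⁻¹) :=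
    intervalIntegral.integral_nonneg hc0.le hn2
  have h0 : 0 ≤ h ^ 2 * phi μ 0 := mul_nonneg (sq_nonneg h) (hphipos 0 hc0.le).le
  rw [functional, hlin, hlin, h1, h2, headFunctional, intervalIntegral.integral_add
    (hc1'.intervalIntegrable_of_Icc hc0.le) (hc2'.intervalIntegrable_of_Icc hc0.le),
    ENNReal.ofReal_add (by positivity) h0, ENNReal.ofReal_add hI1 hI2]
  congr 1
  ring

theorem headFunctional_le [IsProbabilityMeasure μ] [IsProbabilityMeasure ν]
    (hf : ContinuousOn (iteratedDeriv 2 ξ) (Icc (-1) 1))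
    (hpos : ∀ t ∈ Icc (0 : ℝ) 1, 0 ≤ iteratedDeriv 2 ξ t) (hfin : functional ξ h μ < ∞)
    (hle : functional ξ h μ ≤ functional ξ h ν) {c : ℝ} (hc0 : 0 < c) (hc1 : c < 1)
    (heq : ∀ s ∈ Icc c 1, phi ν s = phi μ s) :
    headFunctional ξ h c μ ≤ headFunctional ξ h c ν := by
  have hp := phi_pos_of_functional_lt_top hfin hc1
  have hpν : 0 < phi ν c := by rwa [heq c ⟨le_rfl, hc1.le⟩]
  have hμ := functional_eq_head_add_tail (h := h) hf hpos hc0 hc1 hp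
  have hν := functional_eq_head_add_tail (h := h) hf hpos hc0 hc1 hpν
  have ht1 : (∫⁻ s in Ico c 1, ENNReal.ofReal (iteratedDeriv 2 ξ s * phi ν s)) =
      ∫⁻ s in Ico c 1, ENNReal.ofReal (iteratedDeriv 2 ξ s * phi μ s) :=
    setLIntegral_congr_fun measurableSet_Ico fun s hs => by
      simp only [heq s ⟨hs.1, hs.2.le⟩]
  have ht2 : (∫⁻ s in Ico c 1, ((ENNReal.ofReal (phi ν s))⁻¹ - (ENNReal.ofReal (1 - s))⁻¹)) =
      ∫⁻ s in Ico c 1, ((ENNReal.ofReal (phi μ s))⁻¹ - (ENNReal.ofReal (1 - s))⁻¹) :=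
    setLIntegral_congr_fun measurableSet_Ico fun s hs => by
      simp only [heq s ⟨hs.1, hs.2.le⟩]
  rw [ht1, ht2] at hν
  rw [hμ, hν, ENNReal.mul_le_mul_iff_right (by simp) (by simp)] at hle
  rw [hμ] at hfin
  have hfin' := (ENNReal.add_lt_top.1 (ENNReal.lt_top_of_mul_ne_top_right hfin.ne (by simp))).2
  rw [ENNReal.add_le_add_iff_right hfin'.ne] at hle
  refine (ENNReal.ofReal_le_ofReal_iff ?_).1 hle
  refine add_nonneg (intervalIntegral.integral_nonneg hc0.le fun s hs => ?_)
    (mul_nonneg (sq_nonneg h) (phi_nonneg zero_le_one))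
  have hs1 : s ≤ 1 := hs.2.trans hc1.le
  exact add_nonneg (mul_nonneg (hpos s ⟨hs.1, hs1⟩) (phi_nonneg hs1)) (sub_nonneg.2
    (inv_anti₀ (hpν.trans_le (antitone_phi hs.2)) (phi_le_one_sub hs1)))

/-- The first variation of the functional at `μ`, as a density against the variation of `φ_μ`. -/
noncomputable def phiVariation (ξ : ℝ → ℝ) (μ : Measure ℝ) (s : ℝ) : ℝ :=
  iteratedDeriv 2 ξ s - ((phi μ s) ^ 2)⁻¹

theorem convexComb_mem_Pr01 (hμ : μ ∈ Pr01) (hν : ν ∈ Pr01) {e : ℝ} (he0 : 0 ≤ e) (he1 : e ≤ 1) :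
    ENNReal.ofReal (1 - e) • μ + ENNReal.ofReal e • ν ∈ Pr01 := by
  have := hμ.1
  have := hν.1
  refine ⟨⟨?_⟩, ?_⟩
  · simp only [Measure.add_apply, Measure.smul_apply, measure_univ, smul_eq_mul, mul_one]
    rw [← ENNReal.ofReal_add (by linarith) he0]
    simp
  · simp [hμ.2, hν.2]

theorem phi_convexComb [IsFiniteMeasure μ] [IsFiniteMeasure ν] {e : ℝ} (he0 : 0 ≤ e)
    (he1 : e ≤ 1) (t : ℝ) : phi (ENNReal.ofReal (1 - e) • μ + ENNReal.ofReal e • ν) t =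
      (1 - e) * phi μ t + e * phi ν t := by
  have : ∀ s, (ENNReal.ofReal (1 - e) • μ + ENNReal.ofReal e • ν).real (Icc 0 s) =
      (1 - e) * μ.real (Icc 0 s) + e * ν.real (Icc 0 s) := fun s => by
    have i1 : IsFiniteMeasure (ENNReal.ofReal (1 - e) • μ) := Measure.smul_finite _ (by simp)
    have i2 : IsFiniteMeasure (ENNReal.ofReal e • ν) := Measure.smul_finite _ (by simp)
    rw [measureReal_add_apply, measureReal_ennreal_smul_apply, measureReal_ennreal_smul_apply,
      ENNReal.toReal_ofReal (by linarith), ENNReal.toReal_ofReal he0]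
  simp only [phi, this]
  rw [intervalIntegral.integral_add ((intervalIntegrable_measureReal_Icc _ _).const_mul _)
    ((intervalIntegrable_measureReal_Icc _ _).const_mul _), intervalIntegral.integral_const_mul,
    intervalIntegral.integral_const_mul]

/-- Taylor expansion of the inverse with exact remainder `e²(y-x)²/(x²z)`, where `z` is the convex
combination; all three numbers are at least `κ`. -/
theorem inv_add_mul_sub_le {κ x y e : ℝ} (hκ : 0 < κ) (hx : κ ≤ x) (hy : κ ≤ y) (hx1 : x ≤ 1)
    (hy1 : y ≤ 1) (he0 : 0 ≤ e) (he1 : e ≤ 1) :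
    ((1 - e) * x + e * y)⁻¹ - x⁻¹ ≤ -(e * (y - x) * (x ^ 2)⁻¹) + e ^ 2 * (κ ^ 3)⁻¹ := by
  have hx0 := hκ.trans_le hx
  have hz : κ ≤ (1 - e) * x + e * y := by nlinarith
  set z := (1 - e) * x + e * y with hzd
  have hz0 := hκ.trans_le hz
  have key : z⁻¹ - x⁻¹ = -(e * (y - x) * (x ^ 2)⁻¹) + e ^ 2 * ((y - x) ^ 2 * (x ^ 2 * z)⁻¹) := by
    field_simp
    rw [hzd]; ring
  rw [key]
  have h1 : (x ^ 2 * z)⁻¹ ≤ (κ ^ 3)⁻¹ := by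
    refine inv_anti₀ (by positivity) ?_
    calc κ ^ 3 = κ ^ 2 * κ := by ring
      _ ≤ x ^ 2 * z := by gcongr
  have h2 : (y - x) ^ 2 ≤ 1 := by
    rw [sq_le_one_iff_abs_le_one, abs_le]; constructor <;> linarith
  gcongr
  calc (y - x) ^ 2 * (x ^ 2 * z)⁻¹ ≤ 1 * (κ ^ 3)⁻¹ := by gcongr
    _ = _ := one_mul _

theorem nonneg_of_forall_le_sq {L C : ℝ} (hLC : ∀ e : ℝ, 0 ≤ e → e ≤ 1 → 0 ≤ e * L + e ^ 2 * C) :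
    0 ≤ L := by
  by_contra hL
  push Not at hL
  have hC := hLC 1 zero_le_one le_rfl
  have hC0 : 0 < C := by linarith
  -- `-L/(2C)` minimizes `eL + e²C`; the case `e = 1` gives `C ≥ -L`, so it is admissible.
  have h1 : -L / (2 * C) ≤ 1 := by
    rw [div_le_one (by positivity)]; linarith
  have h2 := hLC (-L / (2 * C)) (div_nonneg (by linarith) (by linarith)) h1
  have h3 : -L / (2 * C) * L + (-L / (2 * C)) ^ 2 * C = -(L ^ 2 / (4 * C)) := by
    field_simp; ring
  rw [h3] at h2
  have : 0 < L ^ 2 / (4 * C) := div_pos (sq_pos_of_neg hL) (by positivity)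
  linarith

/-- Along `(1-e)μ + eν` the head grows by at most `e` times this quantity plus `O(e²)`. The
remainder is uniform since both `φ` are at least `φ_μ(c) > 0` on `[0,c]`; agreement on `[c,1]` keeps
the singular end out. -/
theorem IsOptimal.firstVariation_nonneg (hμ : IsOptimal ξ h μ)
    (hf : ContinuousOn (iteratedDeriv 2 ξ) (Icc (-1) 1))
    (hpos : ∀ t ∈ Icc (0 : ℝ) 1, 0 ≤ iteratedDeriv 2 ξ t) (hν : ν ∈ Pr01)
    {c : ℝ} (hc0 : 0 < c) (hc1 : c < 1) (heq : ∀ s ∈ Icc c 1, phi ν s = phi μ s) :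
    0 ≤ (∫ s in (0 : ℝ)..c, phiVariation ξ μ s * (phi ν s - phi μ s))
      + h ^ 2 * (phi ν 0 - phi μ 0) := by
  have hfin := hμ.functional_lt_top hf
  have := hμ.1.1
  have := hν.1
  set κ := phi μ c with hκ
  have hκ0 : 0 < κ := phi_pos_of_functional_lt_top hfin hc1
  have hlow : ∀ s ≤ c, κ ≤ phi μ s := fun s hs => antitone_phi hs
  have hlowν : ∀ s ≤ c, κ ≤ phi ν s := fun s hs => by
    rw [hκ, ← heq c ⟨le_rfl, hc1.le⟩]; exact antitone_phi hs
  have hsub : Icc 0 c ⊆ Icc (-1 : ℝ) 1 := Icc_subset_Icc (by norm_num) hc1.le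
  have hfc := hf.mono hsub
  have hinv : ContinuousOn (fun s => (phi μ s)⁻¹) (Icc 0 c) :=
    continuous_phi.continuousOn.inv₀ fun s hs => (hκ0.trans_le (hlow s hs.2)).ne'
  have hinv2 : ContinuousOn (fun s => ((phi μ s) ^ 2)⁻¹) (Icc 0 c) :=
    (continuous_phi.pow 2).continuousOn.inv₀
      fun s hs => (pow_pos (hκ0.trans_le (hlow s hs.2)) 2).ne'
  have hone : ContinuousOn (fun s : ℝ => (1 - s)⁻¹) (Icc 0 c) :=
    (by fun_prop : Continuous fun s : ℝ => 1 - s).continuousOn.inv₀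
        fun s hs => by linarith [hs.2]
  have hdiff : ContinuousOn (fun s => phi ν s - phi μ s) (Icc 0 c) :=
    (continuous_phi.sub continuous_phi).continuousOn
  refine nonneg_of_forall_le_sq (C := c * (κ ^ 3)⁻¹) fun e he0 he1 => ?_
  have hmem := convexComb_mem_Pr01 hμ.1 hν he0 he1
  have := hmem.1
  set ρ := ENNReal.ofReal (1 - e) • μ + ENNReal.ofReal e • ν with hρ
  have hphiρ : ∀ t, phi ρ t = (1 - e) * phi μ t + e * phi ν t := phi_convexComb he0 he1
  have hlowρ : ∀ s ≤ c, κ ≤ phi ρ s := fun s hs => by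
    rw [hphiρ]; nlinarith [hlow s hs, hlowν s hs]
  have hinvρ : ContinuousOn (fun s => (phi ρ s)⁻¹) (Icc 0 c) :=
    continuous_phi.continuousOn.inv₀ fun s hs => (hκ0.trans_le (hlowρ s hs.2)).ne'
  have hle := headFunctional_le hf hpos hfin (hμ.2 hmem) hc0 hc1
    fun s hs => by rw [hphiρ, heq s hs]; ring
  rw [headFunctional, headFunctional] at hle
  have hmono : (∫ s in (0 : ℝ)..c, (iteratedDeriv 2 ξ s * phi ρ s + ((phi ρ s)⁻¹ - (1 - s)⁻¹)))
      ≤ ∫ s in (0 : ℝ)..c, ((iteratedDeriv 2 ξ s * phi μ s + ((phi μ s)⁻¹ - (1 - s)⁻¹))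
        + e * (phiVariation ξ μ s * (phi ν s - phi μ s)) + e ^ 2 * (κ ^ 3)⁻¹) := by
    refine intervalIntegral.integral_mono_on hc0.le ?_ ?_ fun s hs => ?_
    · exact ((hfc.mul continuous_phi.continuousOn).add
        (hinvρ.sub hone)).intervalIntegrable_of_Icc hc0.le
    · exact (((hfc.mul continuous_phi.continuousOn).add (hinv.sub hone)).add
        (((hfc.sub hinv2).mul hdiff).const_smul e)).add
          continuousOn_const |>.intervalIntegrable_of_Icc hc0.le
    · have hs1 : s ≤ 1 := hs.2.trans hc1.le
      have h01 : 1 - s ≤ 1 := by linarith [hs.1]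
      have := inv_add_mul_sub_le hκ0 (hlow s hs.2) (hlowν s hs.2)
        ((phi_le_one_sub hs1).trans h01) ((phi_le_one_sub hs1).trans h01) he0 he1
      rw [← hphiρ] at this
      rw [phiVariation, hphiρ]
      rw [hphiρ] at this
      linarith
  have hi1 : IntervalIntegrable (fun s => iteratedDeriv 2 ξ s * phi μ s
      + ((phi μ s)⁻¹ - (1 - s)⁻¹)) volume 0 c :=
    ((hfc.mul continuous_phi.continuousOn).add
      (hinv.sub hone)).intervalIntegrable_of_Icc hc0.le
  have hi2 : IntervalIntegrable (fun s => phiVariation ξ μ s * (phi ν s - phi μ s)) volume 0 c :=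
    ((hfc.sub hinv2).mul hdiff).intervalIntegrable_of_Icc hc0.le
  have hsplit : (∫ s in (0 : ℝ)..c, ((iteratedDeriv 2 ξ s * phi μ s + ((phi μ s)⁻¹ - (1 - s)⁻¹))
        + e * (phiVariation ξ μ s * (phi ν s - phi μ s)) + e ^ 2 * (κ ^ 3)⁻¹)) =
      (∫ s in (0 : ℝ)..c, (iteratedDeriv 2 ξ s * phi μ s + ((phi μ s)⁻¹ - (1 - s)⁻¹)))
        + e * (∫ s in (0 : ℝ)..c, phiVariation ξ μ s * (phi ν s - phi μ s))
        + e ^ 2 * (c * (κ ^ 3)⁻¹) := by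
    have h1 := intervalIntegral.integral_add (hi1.add (hi2.const_mul e))
      (intervalIntegrable_const (c := e ^ 2 * (κ ^ 3)⁻¹))
    have h2 := intervalIntegral.integral_add hi1 (hi2.const_mul e)
    rw [intervalIntegral.integral_const, smul_eq_mul, sub_zero] at h1
    rw [intervalIntegral.integral_const_mul] at h2
    calc _ = _ := h1
      _ = _ := by rw [h2]; ring
  rw [hsplit] at hmono
  rw [hphiρ 0] at hle
  linarith

/-! ### The potential whose second derivative is `-k`. -/

section Potential

/-- The second antiderivative of `-k` with derivative `-h²` at `0`. -/
noncomputable def potential (k : ℝ → ℝ) (h x : ℝ) : ℝ :=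
  -(h ^ 2 * x + (x * ∫ t in (0 : ℝ)..x, k t) - ∫ t in (0 : ℝ)..x, t * k t)

/-- The derivative of `potential k h`. -/
noncomputable def force (k : ℝ → ℝ) (h x : ℝ) : ℝ :=
  -(h ^ 2 + ∫ t in (0 : ℝ)..x, k t)

variable {k : ℝ → ℝ} {x : ℝ}

theorem intervalIntegrable_of_continuousOn_Ioo (hk : ContinuousOn k (Ioo (-1) 1)) {a b : ℝ}
    (ha : a ∈ Ioo (-1 : ℝ) 1) (hb : b ∈ Ioo (-1 : ℝ) 1) : IntervalIntegrable k volume a b :=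
  (hk.mono (ordConnected_Ioo.uIcc_subset ha hb)).intervalIntegrable

theorem hasDerivAt_primitive (hk : ContinuousOn k (Ioo (-1) 1)) (hx : x ∈ Ioo (-1 : ℝ) 1) :
    HasDerivAt (fun x => ∫ t in (0 : ℝ)..x, k t) (k x) x :=
  intervalIntegral.integral_hasDerivAt_right
    (intervalIntegrable_of_continuousOn_Ioo hk (by norm_num) hx)
    (hk.stronglyMeasurableAtFilter isOpen_Ioo x hx) (hk.continuousAt (isOpen_Ioo.mem_nhds hx))

theorem hasDerivAt_force (hk : ContinuousOn k (Ioo (-1) 1)) (hx : x ∈ Ioo (-1 : ℝ) 1) :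
    HasDerivAt (force k h) (-k x) x := by
  exact ((hasDerivAt_primitive hk hx).const_add (h ^ 2)).neg

theorem hasDerivAt_potential (hk : ContinuousOn k (Ioo (-1) 1)) (hx : x ∈ Ioo (-1 : ℝ) 1) :
    HasDerivAt (potential k h) (force k h x) x := by
  have h1 := hasDerivAt_primitive hk hx
  have h2 := hasDerivAt_primitive (continuousOn_id.mul hk) hx
  have h3 := ((((hasDerivAt_id x).const_mul (h ^ 2)).add ((hasDerivAt_id x).mul h1)).sub h2).neg
  refine h3.congr_deriv ?_
  simp only [force, id, Pi.mul_apply]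
  ring

theorem continuousOn_potential (hk : ContinuousOn k (Ioo (-1) 1)) :
    ContinuousOn (potential k h) (Ioo (-1) 1) := fun _ hx =>
  (hasDerivAt_potential hk hx).continuousAt.continuousWithinAt

theorem force_zero : force k h 0 = -h ^ 2 := by simp [force]

theorem integral_mul_max (hk : ContinuousOn k (Ioo (-1) 1)) {c z : ℝ} (hc1 : c < 1)
    (hz : z ∈ Icc 0 c) : ∫ t in (0 : ℝ)..c, k t * max z t =
      (z * ∫ t in (0 : ℝ)..z, k t) + (∫ t in (0 : ℝ)..c, t * k t) - ∫ t in (0 : ℝ)..z, t * k t := by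
  have hsub : ∀ {t}, t ∈ Icc 0 c → t ∈ Ioo (-1 : ℝ) 1 := fun ht =>
    ⟨by linarith [ht.1], by linarith [ht.2]⟩
  have h0 : (0 : ℝ) ∈ Icc 0 c := ⟨le_rfl, hz.1.trans hz.2⟩
  have hcc : c ∈ Icc 0 c := ⟨hz.1.trans hz.2, le_rfl⟩
  have hmax : ContinuousOn (fun t => k t * max z t) (Ioo (-1) 1) :=
    hk.mul (by fun_prop : Continuous fun t : ℝ => max z t).continuousOn
  have hid : ContinuousOn (fun t => t * k t) (Ioo (-1) 1) := continuousOn_id.mul hk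
  rw [← intervalIntegral.integral_add_adjacent_intervals
    (intervalIntegrable_of_continuousOn_Ioo hmax (hsub h0) (hsub hz))
    (intervalIntegrable_of_continuousOn_Ioo hmax (hsub hz) (hsub hcc)),
    ← intervalIntegral.integral_add_adjacent_intervals
    (intervalIntegrable_of_continuousOn_Ioo hid (hsub h0) (hsub hz))
    (intervalIntegrable_of_continuousOn_Ioo hid (hsub hz) (hsub hcc)),
    ← intervalIntegral.integral_const_mul]
  have e1 : ∫ t in (0 : ℝ)..z, k t * max z t = ∫ t in (0 : ℝ)..z, z * k t :=
    intervalIntegral.integral_congr fun t ht => by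
      rw [uIcc_of_le hz.1] at ht
      simp only [max_eq_left ht.2]; ring
  have e2 : ∫ t in z..c, k t * max z t = ∫ t in z..c, t * k t :=
    intervalIntegral.integral_congr fun t ht => by
      rw [uIcc_of_le hz.2] at ht
      simp only [max_eq_right ht.1]; ring
  rw [e1, e2]
  ring

/-- The second derivative of `z ↦ max z t` is the point mass at `t`, so pairing with `k` yields a
second antiderivative of `k`. The term in `h²` keeps the shape `max z 0`, the value at `t = 0` of
the same kernel. -/
theorem integral_mul_max_sub_max (hk : ContinuousOn k (Ioo (-1) 1)) {c y z : ℝ} (hc1 : c < 1)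
    (hy : y ∈ Icc 0 c) (hz : z ∈ Icc 0 c) :
    ∫ t in (0 : ℝ)..c, k t * (max z t - max y t) =
      potential k h y - potential k h z - h ^ 2 * (max z 0 - max y 0) := by
  have hmax : ∀ z : ℝ, IntervalIntegrable (fun t => k t * max z t) volume 0 c := fun z =>
    intervalIntegrable_of_continuousOn_Ioo
      (hk.mul (by fun_prop : Continuous fun t : ℝ => max z t).continuousOn) (by norm_num)
      ⟨by linarith [hy.1, hy.2], hc1⟩
  simp only [mul_sub]
  rw [intervalIntegral.integral_sub (hmax z) (hmax y), integral_mul_max hk hc1 hy,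
    integral_mul_max hk hc1 hz, max_eq_left hy.1, max_eq_left hz.1, potential, potential]
  ring

theorem integral_mul_integral_max_sub_max [IsFiniteMeasure μ]
    (hk : ContinuousOn k (Ioo (-1) 1)) {c y : ℝ} (hc1 : c < 1) (hy : y ∈ Icc 0 c) {A : Set ℝ}
    (hA : MeasurableSet A) (hAc : A ⊆ Icc 0 c) :
    (∫ t in (0 : ℝ)..c, k t * ∫ z in A, (max z t - max y t) ∂μ)
      + h ^ 2 * (∫ z in A, (max z 0 - max y 0) ∂μ)
      = ∫ z in A, (potential k h y - potential k h z) ∂μ := by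
  have hc0 : 0 ≤ c := hy.1.trans hy.2
  have hkc : ContinuousOn k (Icc 0 c) := hk.mono fun t ht => ⟨by linarith [ht.1], by linarith [ht.2]⟩
  have hkint : Integrable k (volume.restrict (Ioc 0 c)) :=
    hkc.integrableOn_Icc.mono_set Ioc_subset_Icc_self
  have hprod : Integrable (fun p : ℝ × ℝ => k p.1 * (max p.2 p.1 - max y p.1))
      ((volume.restrict (Ioc 0 c)).prod (μ.restrict A)) := by
    have h1 : Integrable (fun p : ℝ × ℝ => k p.1 * (1 : ℝ))
        ((volume.restrict (Ioc 0 c)).prod (μ.restrict A)) :=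
      hkint.mul_prod (integrable_const (1 : ℝ))
    simp only [mul_one] at h1
    refine h1.mul_bdd (c := c)
      (by fun_prop : Continuous fun p : ℝ × ℝ => max p.2 p.1 - max y p.1).aestronglyMeasurable ?_
    rw [Measure.prod_restrict]
    filter_upwards [ae_restrict_mem (measurableSet_Ioc.prod hA)] with p hp
    have hp1 := hp.1
    have hp2 := hAc hp.2
    have a1 : max p.2 p.1 ≤ c := max_le hp2.2 hp1.2
    have a2 : max y p.1 ≤ c := max_le hy.2 hp1.2
    have a3 : 0 ≤ max p.2 p.1 := hp2.1.trans (le_max_left _ _)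
    have a4 : 0 ≤ max y p.1 := hy.1.trans (le_max_left _ _)
    rw [Real.norm_eq_abs, abs_le]
    constructor <;> linarith
  have hswap : (∫ t in (0 : ℝ)..c, k t * ∫ z in A, (max z t - max y t) ∂μ) =
      ∫ z in A, (∫ t in (0 : ℝ)..c, k t * (max z t - max y t)) ∂μ := by
    simp only [intervalIntegral.integral_of_le hc0, ← integral_const_mul]
    exact integral_integral_swap hprod
  rw [hswap, setIntegral_congr_fun hA
    (fun z hz => integral_mul_max_sub_max (h := h) hk hc1 hy (hAc hz)), ← integral_const_mul,
    ← integral_add]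
  · simp
  · have hpot : ContinuousOn (potential k h) (Icc 0 c) :=
      (continuousOn_potential hk).mono fun t ht => ⟨by linarith [ht.1], by linarith [ht.2]⟩
    have : ContinuousOn (fun z => potential k h y - potential k h z
        - h ^ 2 * (max z 0 - max y 0)) (Icc 0 c) :=
      (continuousOn_const.sub hpot).sub (by fun_prop)
    exact (this.integrableOn_Icc (μ := μ)).mono_set hAc
  · have : Continuous fun z : ℝ => h ^ 2 * (max z 0 - max y 0) := by fun_prop
    exact (this.continuousOn.integrableOn_Icc (μ := μ)).mono_set hAc

end Potential

/-! ### Moving mass: `μ` is carried by the minimizers of the potential. -/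

theorem integrable_max {t : ℝ} [IsFiniteMeasure μ] (hμ : μ (Icc (0 : ℝ) 1)ᶜ = 0) :
    Integrable (fun z => 1 - max z t) μ := by
  have h1 : IntegrableOn (fun z => 1 - max z t) (Icc 0 1) μ :=
    (by fun_prop : Continuous fun z : ℝ => 1 - max z t).continuousOn.integrableOn_Icc
  rw [IntegrableOn, Measure.restrict_eq_self_of_ae_mem] at h1
  · exact h1
  · rw [ae_iff]; exact hμ

theorem moveMass_mem_Pr01 (hμ : μ ∈ Pr01) {A : Set ℝ} (hA : MeasurableSet A) {y : ℝ}
    (hy : y ∈ Icc (0 : ℝ) 1) : μ.restrict Aᶜ + μ A • Measure.dirac y ∈ Pr01 := by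
  have := hμ.1
  refine ⟨⟨?_⟩, ?_⟩
  · simp only [Measure.add_apply, Measure.smul_apply, measure_univ, smul_eq_mul, mul_one,
      Measure.restrict_apply_univ]
    rw [add_comm, measure_add_measure_compl hA, measure_univ]
  · have h1 : μ.restrict Aᶜ (Icc 0 1)ᶜ = 0 :=
      le_antisymm ((Measure.restrict_apply_le _ _).trans_eq hμ.2) zero_le
    simp [h1, (dirac_mem_Pr01 hy).2]

theorem phi_moveMass_sub (hμ : μ ∈ Pr01) {A : Set ℝ} (hA : MeasurableSet A) {y : ℝ}
    (hy : y ∈ Icc (0 : ℝ) 1) {t : ℝ} (ht : t ≤ 1) :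
    phi (μ.restrict Aᶜ + μ A • Measure.dirac y) t - phi μ t =
      ∫ z in A, (max z t - max y t) ∂μ := by
  have hν := moveMass_mem_Pr01 hμ hA hy
  have := hμ.1
  have := hν.1
  have hint := integrable_max (t := t) hμ.2
  rw [phi_eq_integral_max hν.2 ht, phi_eq_integral_max hμ.2 ht, integral_add_measure hint.restrict
    ((integrable_dirac (by simp)).smul_measure (measure_ne_top _ _)), integral_smul_measure,
    integral_dirac, ← integral_add_compl hA hint]
  have h1 : ∫ z in A, (max z t - max y t) ∂μ =
      ∫ z in A, ((1 - max y t) - (1 - max z t)) ∂μ := by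
    congr 1; ext z; ring
  rw [h1, integral_sub (integrable_const _) hint.restrict, setIntegral_const]
  simp only [measureReal_def, smul_eq_mul]
  ring

theorem continuousOn_phiVariation [IsProbabilityMeasure μ]
    (hf : ContinuousOn (iteratedDeriv 2 ξ) (Icc (-1) 1)) (hfin : functional ξ h μ < ∞) :
    ContinuousOn (phiVariation ξ μ) (Ioo (-1) 1) :=
  (hf.mono Ioo_subset_Icc_self).sub ((continuous_phi.pow 2).continuousOn.inv₀
    fun _ hs => (pow_pos (phi_pos_of_functional_lt_top hfin hs.2) 2).ne')

/-- The competitor sends all mass of `A` to `y`. As `A` and `y` lie in `[0,c]`, `φ` is unchanged on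
`[c,1]` and the first variation applies. -/
theorem IsOptimal.setIntegral_potential_nonneg (hμ : IsOptimal ξ h μ)
    (hf : ContinuousOn (iteratedDeriv 2 ξ) (Icc (-1) 1))
    (hpos : ∀ t ∈ Icc (0 : ℝ) 1, 0 ≤ iteratedDeriv 2 ξ t) {c y : ℝ} (hc0 : 0 < c) (hc1 : c < 1)
    (hy : y ∈ Icc 0 c) {A : Set ℝ} (hA : MeasurableSet A) (hAc : A ⊆ Icc 0 c) :
    0 ≤ ∫ z in A, (potential (phiVariation ξ μ) h y - potential (phiVariation ξ μ) h z) ∂μ := by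
  have := hμ.1.1
  have hy1 : y ∈ Icc (0 : ℝ) 1 := ⟨hy.1, hy.2.trans hc1.le⟩
  have hk := continuousOn_phiVariation hf (hμ.functional_lt_top hf)
  rw [← integral_mul_integral_max_sub_max hk hc1 hy hA hAc]
  have key := hμ.firstVariation_nonneg hf hpos (moveMass_mem_Pr01 hμ.1 hA hy1) hc0 hc1 ?_
  · rw [phi_moveMass_sub hμ.1 hA hy1 zero_le_one] at key
    convert key using 2
    refine intervalIntegral.integral_congr fun t ht => ?_
    rw [uIcc_of_le hc0.le] at ht
    rw [phi_moveMass_sub hμ.1 hA hy1 (ht.2.trans hc1.le)]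
  · intro s hs
    rw [← sub_eq_zero, phi_moveMass_sub hμ.1 hA hy1 hs.2]
    rw [setIntegral_congr_fun (g := fun _ => 0) hA]
    · simp
    · intro z hz
      simp only
      rw [max_eq_right ((hAc hz).2.trans hs.1), max_eq_right (hy.2.trans hs.1), sub_self]

/-- The minimizers over `[0,1)` of the potential of `μ`. -/
def minSet (ξ : ℝ → ℝ) (h : ℝ) (μ : Measure ℝ) : Set ℝ :=
  {z ∈ Ico (0 : ℝ) 1 | IsMinOn (potential (phiVariation ξ μ) h) (Ico 0 1) z}

theorem IsOptimal.measure_potential_gt (hμ : IsOptimal ξ h μ)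
    (hf : ContinuousOn (iteratedDeriv 2 ξ) (Icc (-1) 1))
    (hpos : ∀ t ∈ Icc (0 : ℝ) 1, 0 ≤ iteratedDeriv 2 ξ t) {c y : ℝ} (hc0 : 0 < c) (hc1 : c < 1)
    (hy : y ∈ Icc 0 c) : μ (Icc 0 c ∩ {z | potential (phiVariation ξ μ) h y <
      potential (phiVariation ξ μ) h z}) = 0 := by
  have := hμ.1.1
  have hk := continuousOn_phiVariation hf (hμ.functional_lt_top hf)
  set G := potential (phiVariation ξ μ) h with hG
  have hGc : ContinuousOn G (Ioo (-1) 1) := continuousOn_potential hk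
  have hsub : Icc 0 c ⊆ Ioo (-1 : ℝ) 1 := fun t ht => ⟨by linarith [ht.1], by linarith [ht.2]⟩
  set A := Icc 0 c ∩ {z | G y < G z} with hAdef
  -- Continuity of the potential is known only on `(-1,1)`; intersecting with it gives
  -- measurability.
  have hAeq : A = Icc 0 c ∩ (Ioo (-1) 1 ∩ G ⁻¹' Ioi (G y)) := by
    ext z
    exact ⟨fun hz => ⟨hz.1, hsub hz.1, hz.2⟩, fun hz => ⟨hz.1, hz.2.2⟩⟩
  have hA : MeasurableSet A := by
    rw [hAeq]
    exact measurableSet_Icc.inter (hGc.isOpen_inter_preimage isOpen_Ioo isOpen_Ioi).measurableSet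
  have hAc : A ⊆ Icc 0 c := inter_subset_left
  have h0 := hμ.setIntegral_potential_nonneg hf hpos hc0 hc1 hy hA hAc
  have hint : IntegrableOn (fun z => G z - G y) A μ :=
    (((hGc.mono hsub).sub continuousOn_const).integrableOn_Icc).mono_set hAc
  by_contra hne
  have hp : 0 < ∫ z in A, (G z - G y) ∂μ := by
    rw [setIntegral_pos_iff_support_of_nonneg_ae _ hint]
    · have : Function.support (fun z => G z - G y) ∩ A = A :=
        inter_eq_right.2 fun z hz => (sub_pos.2 hz.2).ne'
      rw [this]
      exact pos_iff_ne_zero.2 hne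
    · filter_upwards [ae_restrict_mem hA] with z hz using (sub_pos.2 hz.2).le
  have hneg : ∫ z in A, (G y - G z) ∂μ = -∫ z in A, (G z - G y) ∂μ := by
    rw [← integral_neg]; congr 1; ext z; ring
  linarith

/-- Any nonminimizer has a larger potential than some rational point, so countably many null sets,
indexed by a rational and a cut-off below `1`, cover the complement. -/
theorem IsOptimal.measure_compl_minSet (hμ : IsOptimal ξ h μ)
    (hf : ContinuousOn (iteratedDeriv 2 ξ) (Icc (-1) 1))
    (hpos : ∀ t ∈ Icc (0 : ℝ) 1, 0 ≤ iteratedDeriv 2 ξ t) : μ (minSet ξ h μ)ᶜ = 0 := by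
  have := hμ.1.1
  have hfin := hμ.functional_lt_top hf
  have hk := continuousOn_phiVariation hf hfin
  set G := potential (phiVariation ξ μ) h with hG
  have hGc : ContinuousOn G (Ioo (-1) 1) := continuousOn_potential hk
  have hcover : (minSet ξ h μ)ᶜ ⊆ ((Icc 0 1)ᶜ ∪ {1}) ∪ ⋃ (n : ℕ) (q : ℚ),
      (if (q : ℝ) ∈ Icc (0 : ℝ) (1 - 1 / (n + 2)) then
        Icc (0 : ℝ) (1 - 1 / (n + 2)) ∩ {z | G q < G z} else ∅) := by
    intro z hz
    by_cases hz01 : z ∈ Ico (0 : ℝ) 1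
    · right
      have : ∃ y ∈ Ico (0 : ℝ) 1, G y < G z := by
        by_contra hcon
        push Not at hcon
        exact hz ⟨hz01, fun y hy => hcon y hy⟩
      obtain ⟨y, hy, hyz⟩ := this
      have hyU : y ∈ Ioo (-1 : ℝ) 1 := ⟨by linarith [hy.1], hy.2⟩
      -- Approximating from the right keeps the rational in `[0,1)` even when `y = 0`.
      have hev : ∀ᶠ x in nhdsWithin y (Ioi y), G x < G z ∧ x ∈ Ioo y 1 := by
        refine Filter.Eventually.and ?_ (Ioo_mem_nhdsGT hy.2)
        exact ((hGc.continuousAt (isOpen_Ioo.mem_nhds hyU)).eventually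
          (gt_mem_nhds hyz)).filter_mono nhdsWithin_le_nhds
      obtain ⟨u, hu, hsub⟩ := (mem_nhdsGT_iff_exists_Ioo_subset).1 hev
      obtain ⟨q, hq1, hq2⟩ := exists_rat_btwn (show y < u from hu)
      obtain ⟨hqG, hq⟩ := hsub ⟨hq1, hq2⟩
      have hm : 0 < 1 - max z q := sub_pos.2 (max_lt hz01.2 hq.2)
      obtain ⟨n, hn⟩ := exists_nat_one_div_lt hm
      have hn2 : (1 : ℝ) / (n + 2) ≤ 1 / (n + 1) := by
        apply one_div_le_one_div_of_le <;> [positivity; linarith]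
      have hzle : z ≤ 1 - 1 / ((n : ℝ) + 2) := by linarith [le_max_left z (q : ℝ)]
      have hqle : (q : ℝ) ≤ 1 - 1 / ((n : ℝ) + 2) := by linarith [le_max_right z (q : ℝ)]
      refine mem_iUnion₂.2 ⟨n, q, ?_⟩
      rw [if_pos ⟨hy.1.trans hq1.le, hqle⟩]
      exact ⟨⟨hz01.1, hzle⟩, hqG⟩
    · left
      by_cases h1 : z = 1
      · exact Or.inr h1
      · exact Or.inl fun h => hz01 ⟨h.1, lt_of_le_of_ne h.2 h1⟩
  refine measure_mono_null hcover (measure_union_null (measure_union_null hμ.1.2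
    (measure_singleton_one_of_functional_lt_top hfin)) ?_)
  refine measure_iUnion_null fun n => measure_iUnion_null fun q => ?_
  split_ifs with hq
  -- With `n + 2` the cut-off `1 - 1/(n+2)` is positive also for `n = 0`.
  · have h2 : (1 : ℝ) / ((n : ℝ) + 2) < 1 := by
      rw [div_lt_one (by positivity)]
      linarith [(Nat.cast_nonneg n : (0 : ℝ) ≤ n)]
    exact hμ.measure_potential_gt hf hpos (by linarith) (by
      have : (0 : ℝ) < 1 / ((n : ℝ) + 2) := by positivity
      linarith) hq
  · exact measure_empty

/-! ### First and second order conditions at minimizers of the potential. -/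

section Minimizers

variable {k : ℝ → ℝ} {z : ℝ}

theorem potential_lt_of_force_neg (hk : ContinuousOn k (Ioo (-1) 1)) {u : ℝ} (hz : -1 < z)
    (hzu : z < u) (hu : u < 1) (hneg : ∀ x ∈ Ioo z u, force k h x < 0) :
    potential k h u < potential k h z := by
  have hsub : Icc z u ⊆ Ioo (-1 : ℝ) 1 := fun x hx => ⟨hz.trans_le hx.1, hx.2.trans_lt hu⟩
  refine strictAntiOn_of_deriv_neg (convex_Icc z u) ((continuousOn_potential hk).mono hsub)
    (fun x hx => ?_) (left_mem_Icc.2 hzu.le) (right_mem_Icc.2 hzu.le) hzu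
  rw [interior_Icc] at hx
  rw [(hasDerivAt_potential hk (hsub (Ioo_subset_Icc_self hx))).deriv]
  exact hneg x hx

theorem continuousOn_force (hk : ContinuousOn k (Ioo (-1) 1)) :
    ContinuousOn (force k h) (Ioo (-1) 1) := fun _ hx =>
  (hasDerivAt_force hk hx).continuousAt.continuousWithinAt

theorem exists_Icc_of_continuousOn {F : ℝ → ℝ} (hF : ContinuousOn F (Ioo (-1) 1))
    (hz : z ∈ Ico (0 : ℝ) 1) {s : Set ℝ} (hs : IsOpen s) (hzs : F z ∈ s) :
    ∃ u, z < u ∧ u < 1 ∧ ∀ x ∈ Icc z u, F x ∈ s := by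
  have hzU : z ∈ Ioo (-1 : ℝ) 1 := ⟨by linarith [hz.1], hz.2⟩
  have hev := (hF.continuousAt (isOpen_Ioo.mem_nhds hzU)).eventually (hs.mem_nhds hzs)
  have hev2 := (hev.filter_mono (nhdsWithin_le_nhds (s := Ici z)))
  obtain ⟨u, hu, hsub⟩ := (mem_nhdsGE_iff_exists_Icc_subset).1 hev2
  exact ⟨min u ((z + 1) / 2), lt_min hu (by linarith [hz.2]),
    (min_le_right _ _).trans_lt (by linarith [hz.2]),
    fun x hx => hsub ⟨hx.1, hx.2.trans (min_le_left _ _)⟩⟩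

/-- Inside, this is Fermat's rule. At `z = 0` the force is `-h² ≤ 0`, while minimality at a left end
point forbids a negative derivative. -/
theorem force_eq_zero_of_isMinOn (hk : ContinuousOn k (Ioo (-1) 1)) (hz : z ∈ Ico (0 : ℝ) 1)
    (hmin : IsMinOn (potential k h) (Ico 0 1) z) : force k h z = 0 := by
  rcases hz.1.eq_or_lt with h0 | h0
  · refine le_antisymm ?_ ?_
    · rw [← h0, force_zero]; linarith [sq_nonneg h]
    · by_contra hneg
      push Not at hneg
      obtain ⟨u, hzu, hu1, hu⟩ := exists_Icc_of_continuousOn (continuousOn_force hk) hz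
        isOpen_Iio hneg
      exact (hmin ⟨hz.1.trans hzu.le, hu1⟩ : potential k h z ≤ potential k h u).not_gt
        (potential_lt_of_force_neg hk (by linarith [hz.1]) hzu hu1
          fun x hx => hu x (Ioo_subset_Icc_self hx))
  · exact (hmin.isLocalMin (Ico_mem_nhds h0 hz.2)).hasDerivAt_eq_zero
      (hasDerivAt_potential hk ⟨by linarith, hz.2⟩)

/-- If `k z > 0`, the force decreases from `0` to the right of `z` and the potential drops. Only the
right side is used, so `z = 0` is covered. -/
theorem nonpos_of_isMinOn (hk : ContinuousOn k (Ioo (-1) 1)) (hz : z ∈ Ico (0 : ℝ) 1)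
    (hmin : IsMinOn (potential k h) (Ico 0 1) z) : k z ≤ 0 := by
  by_contra hpos
  push Not at hpos
  obtain ⟨u, hzu, hu1, hu⟩ := exists_Icc_of_continuousOn hk hz isOpen_Ioi hpos
  have hsub : Icc z u ⊆ Ioo (-1 : ℝ) 1 := fun x hx =>
    ⟨by linarith [hx.1, hz.1], hx.2.trans_lt hu1⟩
  have hanti : StrictAntiOn (force k h) (Icc z u) :=
    strictAntiOn_of_deriv_neg (convex_Icc z u) ((continuousOn_force hk).mono hsub) fun x hx => by
      rw [interior_Icc] at hx
      rw [(hasDerivAt_force hk (hsub (Ioo_subset_Icc_self hx))).deriv]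
      exact neg_lt_zero.2 (hu x (Ioo_subset_Icc_self hx))
  refine (hmin ⟨hz.1.trans hzu.le, hu1⟩ : potential k h z ≤ potential k h u).not_gt
    (potential_lt_of_force_neg hk (by linarith [hz.1]) hzu hu1 fun x hx => ?_)
  rw [← force_eq_zero_of_isMinOn hk hz hmin]
  exact hanti (left_mem_Icc.2 hzu.le) (Ioo_subset_Icc_self hx) hx.1

theorem exists_zero_of_force_eq (hk : ContinuousOn k (Ioo (-1) 1)) {x y : ℝ} (hx : -1 < x)
    (hxy : x < y) (hy : y < 1) (heq : force k h x = force k h y) : ∃ c ∈ Ioo x y, k c = 0 := by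
  have hsub : Icc x y ⊆ Ioo (-1 : ℝ) 1 := fun t ht => ⟨hx.trans_le ht.1, ht.2.trans_lt hy⟩
  obtain ⟨c, hc, h0⟩ := exists_hasDerivAt_eq_zero hxy ((continuousOn_force hk).mono hsub) heq
    fun t ht => hasDerivAt_force hk (hsub (Ioo_subset_Icc_self ht))
  exact ⟨c, hc, neg_eq_zero.1 h0⟩

theorem exists_force_eq_zero (hk : ContinuousOn k (Ioo (-1) 1)) {x y : ℝ} (hx : -1 < x)
    (hxy : x < y) (hy : y < 1) (heq : potential k h x = potential k h y) :
    ∃ c ∈ Ioo x y, force k h c = 0 := by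
  have hsub : Icc x y ⊆ Ioo (-1 : ℝ) 1 := fun t ht => ⟨hx.trans_le ht.1, ht.2.trans_lt hy⟩
  exact exists_hasDerivAt_eq_zero hxy ((continuousOn_potential hk).mono hsub) heq
    fun t ht => hasDerivAt_potential hk (hsub (Ioo_subset_Icc_self ht))

/-- Three minimizers of the potential force three zeros of its second derivative. -/
theorem exists_three_zeros (hk : ContinuousOn k (Ioo (-1) 1)) {x y z : ℝ}
    (hx : x ∈ Ico (0 : ℝ) 1) (hy : y ∈ Ico (0 : ℝ) 1) (hz : z ∈ Ico (0 : ℝ) 1)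
    (hxm : IsMinOn (potential k h) (Ico 0 1) x) (hym : IsMinOn (potential k h) (Ico 0 1) y)
    (hzm : IsMinOn (potential k h) (Ico 0 1) z) (hxy : x < y) (hyz : y < z) :
    ∃ p₁ p₂ p₃, x < p₁ ∧ p₁ < p₂ ∧ p₂ < p₃ ∧ p₃ < z ∧ k p₁ = 0 ∧ k p₂ = 0 ∧ k p₃ = 0 := by
  have hx1 : -1 < x := by linarith [hx.1]
  -- Rolle for the potential interlaces zeros `x < c < y < d < z` of the force; Rolle for the force
  -- on the first three of the four intervals gives the zeros of `k`.
  obtain ⟨c, hc, hc0⟩ := exists_force_eq_zero (h := h) hk hx1 hxy hy.2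
    (le_antisymm (hxm hy) (hym hx))
  obtain ⟨d, hd, hd0⟩ := exists_force_eq_zero (h := h) hk (hx1.trans hxy) hyz hz.2
    (le_antisymm (hym hz) (hzm hy))
  have fx := force_eq_zero_of_isMinOn hk hx hxm
  have fy := force_eq_zero_of_isMinOn hk hy hym
  obtain ⟨p₁, h1, z1⟩ := exists_zero_of_force_eq (h := h) hk hx1 hc.1 (hc.2.trans hy.2)
    (by rw [fx, hc0])
  obtain ⟨p₂, h2, z2⟩ := exists_zero_of_force_eq (h := h) hk (hx1.trans hc.1) hc.2 hy.2
    (by rw [fy, hc0])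
  obtain ⟨p₃, h3, z3⟩ := exists_zero_of_force_eq (h := h) hk (hx1.trans hxy) hd.1
    (hd.2.trans hz.2) (by rw [fy, hd0])
  exact ⟨p₁, p₂, p₃, h1.1, h1.2.trans h2.1, h2.2.trans h3.1, h3.2.trans hd.2, z1, z2, z3⟩

end Minimizers

/-! ### Comparison of `φ_μ` with `1/√ξ''`. -/

/-- The function `1/√ξ''`, of which `dfun ξ` is the second derivative. -/
noncomputable def invSqrt (ξ : ℝ → ℝ) (t : ℝ) : ℝ := 1 / √(iteratedDeriv 2 ξ t)

/-- This turns the sign of `k`, nonlinear in `φ_μ`, into the sign of a difference to which convexity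
applies. -/
theorem phiVariation_nonpos_iff {t : ℝ} (hf : 0 < iteratedDeriv 2 ξ t) (hp : 0 < phi μ t) :
    phiVariation ξ μ t ≤ 0 ↔ phi μ t ≤ invSqrt ξ t := by
  rw [phiVariation, invSqrt, sub_nonpos, le_inv_comm₀ hf (by positivity), one_div,
    ← Real.sqrt_inv, Real.le_sqrt hp.le (by positivity)]

theorem phiVariation_eq_zero_iff {t : ℝ} (hf : 0 < iteratedDeriv 2 ξ t) (hp : 0 < phi μ t) :
    phiVariation ξ μ t = 0 ↔ phi μ t = invSqrt ξ t := by
  rw [phiVariation, invSqrt, sub_eq_zero, one_div, ← Real.sqrt_inv, eq_comm (a := phi μ t),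
    Real.sqrt_eq_iff_eq_sq (by positivity) hp.le, inv_eq_iff_eq_inv]

theorem integral_inv_one_sub_sq {z : ℝ} (hz0 : 0 ≤ z) (hz : z < 1) :
    ∫ t in (0 : ℝ)..z, ((1 - t) ^ 2)⁻¹ = (1 - z)⁻¹ - 1 := by
  have hne : ∀ t ∈ uIcc 0 z, 1 - t ≠ 0 := fun t ht => by
    rw [uIcc_of_le hz0] at ht; linarith [ht.2]
  rw [intervalIntegral.integral_eq_sub_of_hasDerivAt (f := fun t => (1 - t)⁻¹)]
  · simp
  · intro t ht
    have := (((hasDerivAt_id t).const_sub 1).inv (hne t ht))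
    refine this.congr_deriv ?_
    simp [one_div]
  · refine ContinuousOn.intervalIntegrable ?_
    exact (by fun_prop : Continuous fun t : ℝ => (1 - t) ^ 2).continuousOn.inv₀
      fun t ht => pow_ne_zero 2 (hne t ht)

/-- Vanishing force at `z` reads `∫₀ᶻ φ_μ⁻² = h² + ∫₀ᶻ ξ''`. The left side is at least `1/(1-z) - 1`
because `φ_μ ≤ 1 - t`, and the right side is bounded. -/
theorem IsOptimal.exists_minSet_subset (hμ : IsOptimal ξ h μ)
    (hf : ContinuousOn (iteratedDeriv 2 ξ) (Icc (-1) 1))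
    (hpos : ∀ t ∈ Icc (0 : ℝ) 1, 0 ≤ iteratedDeriv 2 ξ t) :
    ∃ c < 1, minSet ξ h μ ⊆ Icc 0 c := by
  have := hμ.1.1
  have hfin := hμ.functional_lt_top hf
  have hk := continuousOn_phiVariation hf hfin
  set F := ∫ t in (0 : ℝ)..1, iteratedDeriv 2 ξ t with hF
  have hfi : ∀ {a b : ℝ}, 0 ≤ a → a ≤ b → b ≤ 1 →
      IntervalIntegrable (iteratedDeriv 2 ξ) volume a b := fun {a b} ha hab hb =>
    (hf.mono (Icc_subset_Icc (by linarith) hb)).intervalIntegrable_of_Icc hab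
  have hF0 : 0 ≤ F := intervalIntegral.integral_nonneg zero_le_one hpos
  have hK : 0 < 1 + h ^ 2 + F := by positivity
  refine ⟨1 - (1 + h ^ 2 + F)⁻¹, by linarith [inv_pos.2 hK], fun z hz => ⟨hz.1.1, ?_⟩⟩
  have hz1 := hz.1.2
  have h0 := force_eq_zero_of_isMinOn hk hz.1 hz.2
  have hinv : ContinuousOn (fun t => ((phi μ t) ^ 2)⁻¹) (Icc 0 z) :=
    (continuous_phi.pow 2).continuousOn.inv₀
      fun s hs => (pow_pos (phi_pos_of_functional_lt_top hfin (hs.2.trans_lt hz1)) 2).ne'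
  have hsplit : ∫ t in (0 : ℝ)..z, phiVariation ξ μ t =
      (∫ t in (0 : ℝ)..z, iteratedDeriv 2 ξ t) - ∫ t in (0 : ℝ)..z, ((phi μ t) ^ 2)⁻¹ :=
    intervalIntegral.integral_sub (hfi le_rfl hz.1.1 hz1.le)
      (hinv.intervalIntegrable_of_Icc hz.1.1)
  have h1 : ∫ t in (0 : ℝ)..z, iteratedDeriv 2 ξ t ≤ F := by
    rw [hF, ← intervalIntegral.integral_add_adjacent_intervals (hfi le_rfl hz.1.1 hz1.le)
      (hfi hz.1.1 hz1.le le_rfl)]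
    have := intervalIntegral.integral_nonneg (μ := volume) hz1.le
      (fun t ht => hpos t ⟨hz.1.1.trans ht.1, ht.2⟩)
    linarith
  have h2 : (1 - z)⁻¹ - 1 ≤ ∫ t in (0 : ℝ)..z, ((phi μ t) ^ 2)⁻¹ := by
    rw [← integral_inv_one_sub_sq hz.1.1 hz1]
    refine intervalIntegral.integral_mono_on hz.1.1 ?_
      (hinv.intervalIntegrable_of_Icc hz.1.1) fun t ht => ?_
    · refine ContinuousOn.intervalIntegrable_of_Icc hz.1.1 ?_
      exact (by fun_prop : Continuous fun t : ℝ => (1 - t) ^ 2).continuousOn.inv₀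
        fun t ht => pow_ne_zero 2 (by linarith [ht.2])
    · have hp := phi_pos_of_functional_lt_top hfin (ht.2.trans_lt hz1)
      have := phi_le_one_sub (μ := μ) (ht.2.trans hz1.le)
      exact inv_anti₀ (by positivity) (by gcongr)
  rw [force, hsplit] at h0
  have h3 : (1 - z)⁻¹ ≤ 1 + h ^ 2 + F := by linarith
  have := inv_le_of_inv_le₀ (by linarith) h3
  linarith

theorem IsOptimal.isCompact_minSet (hμ : IsOptimal ξ h μ)
    (hf : ContinuousOn (iteratedDeriv 2 ξ) (Icc (-1) 1))
    (hpos : ∀ t ∈ Icc (0 : ℝ) 1, 0 ≤ iteratedDeriv 2 ξ t) : IsCompact (minSet ξ h μ) := by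
  have := hμ.1.1
  have hk := continuousOn_phiVariation hf (hμ.functional_lt_top hf)
  obtain ⟨c, hc, hsub⟩ := hμ.exists_minSet_subset hf hpos
  have hGc : ContinuousOn (potential (phiVariation ξ μ) h) (Icc 0 c) :=
    (continuousOn_potential hk).mono fun t ht => ⟨by linarith [ht.1], by linarith [ht.2]⟩
  refine isCompact_Icc.of_isClosed_subset ?_ hsub
  have : minSet ξ h μ = ⋂ (y : ℝ) (_ : y ∈ Ico (0 : ℝ) 1), Icc 0 c ∩
      (potential (phiVariation ξ μ) h) ⁻¹' Iic (potential (phiVariation ξ μ) h y) := by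
    ext z
    simp only [mem_iInter]
    refine ⟨fun hz y hy => ⟨hsub hz, hz.2 hy⟩, fun hz => ?_⟩
    have h0 := (hz 0 ⟨le_rfl, one_pos⟩).1
    exact ⟨⟨h0.1, h0.2.trans_lt hc⟩, fun y hy => (hz y hy).2⟩
  rw [this]
  exact isClosed_iInter fun y => isClosed_iInter fun _ =>
    hGc.preimage_isClosed_of_isClosed isClosed_Icc isClosed_Iic

/-- `μ([0,t])` is constant on `[x,y)`, so `φ_μ` is affine up to the end points; only convexity is
needed. -/
theorem convexOn_phi_of_measure_Ioo_eq_zero [IsFiniteMeasure μ] {x y : ℝ}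
    (h0 : μ (Ioo x y) = 0) : ConvexOn ℝ (Icc x y) (phi μ) := by
  have hm : ∀ t ∈ Ico x y, μ.real (Icc 0 t) = μ.real (Icc 0 x) := fun t ht => by
    refine le_antisymm ?_ (monotone_measureReal_Icc ht.1)
    have h1 : Icc 0 t ⊆ Icc 0 x ∪ Ioo x y := fun s hs => by
      by_cases hsx : s ≤ x
      · exact Or.inl ⟨hs.1, hsx⟩
      · exact Or.inr ⟨not_le.1 hsx, hs.2.trans_lt ht.2⟩
    have h2 := (measureReal_mono h1).trans (measureReal_union_le (μ := μ) _ _)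
    rwa [measureReal_def μ (Ioo x y), h0, ENNReal.toReal_zero, add_zero] at h2
  have hphi : ∀ t ∈ Icc x y, phi μ t = phi μ x - μ.real (Icc 0 x) * (t - x) := fun t ht => by
    have h1 := phi_sub_phi (μ := μ) x t
    have h2 : ∫ s in x..t, μ.real (Icc 0 s) = ∫ s in x..t, μ.real (Icc 0 x) :=
      intervalIntegral.integral_congr_Ioo_of_le ht.1 fun s hs =>
        hm s ⟨hs.1.le, hs.2.trans_le ht.2⟩
    rw [h2, intervalIntegral.integral_const, smul_eq_mul] at h1
    linarith
  refine ⟨convex_Icc x y, fun s hs t ht a b ha hb hab => le_of_eq ?_⟩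
  rw [hphi s hs, hphi t ht, hphi _ (convex_Icc x y hs ht ha hb hab)]
  simp only [smul_eq_mul]
  obtain rfl : a = 1 - b := by linarith
  ring

/-- `invSqrt ξ - phi μ` is concave on the gap and nonnegative at its ends, hence nonnegative. So `k
≤ 0`, the force is monotone, and it vanishes at both ends. -/
theorem IsOptimal.force_eq_zero_of_gap (hμ : IsOptimal ξ h μ)
    (hf : ContinuousOn (iteratedDeriv 2 ξ) (Icc (-1) 1))
    (hpos : ∀ t ∈ Icc (0 : ℝ) 1, 0 ≤ iteratedDeriv 2 ξ t) {x y : ℝ}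
    (hx : x ∈ minSet ξ h μ) (hy : y ∈ minSet ξ h μ) (hxy : x < y)
    (hgap : Disjoint (Ioo x y) (minSet ξ h μ)) (hfp : ∀ t ∈ Icc x y, 0 < iteratedDeriv 2 ξ t)
    (hq : ConcaveOn ℝ (Icc x y) (invSqrt ξ)) :
    ∀ t ∈ Icc x y, force (phiVariation ξ μ) h t = 0 := by
  have := hμ.1.1
  have hfin := hμ.functional_lt_top hf
  have hk := continuousOn_phiVariation hf hfin
  have hsub : Icc x y ⊆ Ioo (-1 : ℝ) 1 := fun t ht =>
    ⟨by linarith [ht.1, hx.1.1], ht.2.trans_lt hy.1.2⟩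
  have hp : ∀ t ∈ Icc x y, 0 < phi μ t := fun t ht =>
    phi_pos_of_functional_lt_top hfin (hsub ht).2
  have h0 : μ (Ioo x y) = 0 :=
    measure_mono_null hgap.subset_compl_right (hμ.measure_compl_minSet hf hpos)
  have hconc : ConcaveOn ℝ (Icc x y) (invSqrt ξ - phi μ) :=
    hq.sub (convexOn_phi_of_measure_Ioo_eq_zero h0)
  have hxI := left_mem_Icc.2 hxy.le
  have hyI := right_mem_Icc.2 hxy.le
  have hwx := (phiVariation_nonpos_iff (hfp x hxI) (hp x hxI)).1 (nonpos_of_isMinOn hk hx.1 hx.2)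
  have hwy := (phiVariation_nonpos_iff (hfp y hyI) (hp y hyI)).1 (nonpos_of_isMinOn hk hy.1 hy.2)
  have hkn : ∀ t ∈ Icc x y, phiVariation ξ μ t ≤ 0 := fun t ht => by
    rw [phiVariation_nonpos_iff (hfp t ht) (hp t ht), ← sub_nonneg]
    have := hconc.min_le_of_mem_Icc hxI hyI ht
    exact (le_min (sub_nonneg.2 hwx) (sub_nonneg.2 hwy)).trans this
  have hmono : MonotoneOn (force (phiVariation ξ μ) h) (Icc x y) := by
    refine monotoneOn_of_deriv_nonneg (convex_Icc x y) ((continuousOn_force hk).mono hsub)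
      (fun t ht => ?_) fun t ht => ?_
    · exact (hasDerivAt_force hk (hsub (interior_subset ht))).differentiableAt.differentiableWithinAt
    · rw [(hasDerivAt_force hk (hsub (interior_subset ht))).deriv]
      exact neg_nonneg.2 (hkn t (interior_subset ht))
  intro t ht
  refine le_antisymm ?_ ?_
  · rw [← force_eq_zero_of_isMinOn hk hy.1 hy.2]; exact hmono ht hyI ht.2
  · rw [← force_eq_zero_of_isMinOn hk hx.1 hx.2]; exact hmono hxI ht ht.1

/-- A point that is not a minimizer lies in a gap between its nearest minimizers, found by
compactness. The force thus vanishes on all of `[r₁,r₂]`, and so does its derivative `-k` inside. -/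
theorem IsOptimal.phi_eq_invSqrt (hμ : IsOptimal ξ h μ)
    (hf : ContinuousOn (iteratedDeriv 2 ξ) (Icc (-1) 1))
    (hpos : ∀ t ∈ Icc (0 : ℝ) 1, 0 ≤ iteratedDeriv 2 ξ t) {r₁ r₂ : ℝ}
    (h₁ : r₁ ∈ minSet ξ h μ) (h₂ : r₂ ∈ minSet ξ h μ)
    (hfp : ∀ t ∈ Icc r₁ r₂, 0 < iteratedDeriv 2 ξ t)
    (hq : ConcaveOn ℝ (Icc r₁ r₂) (invSqrt ξ)) :
    ∀ t ∈ Ioo r₁ r₂, phi μ t = invSqrt ξ t := by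
  have := hμ.1.1
  have hfin := hμ.functional_lt_top hf
  have hk := continuousOn_phiVariation hf hfin
  have hcpt := hμ.isCompact_minSet hf hpos
  have hsub : Icc r₁ r₂ ⊆ Ioo (-1 : ℝ) 1 := fun t ht =>
    ⟨by linarith [ht.1, h₁.1.1], ht.2.trans_lt h₂.1.2⟩
  have hforce : ∀ t ∈ Icc r₁ r₂, force (phiVariation ξ μ) h t = 0 := by
    intro t ht
    by_cases htM : t ∈ minSet ξ h μ
    · exact force_eq_zero_of_isMinOn hk htM.1 htM.2
    have hL := (hcpt.inter_right (isClosed_Icc (a := r₁) (b := t))).sSup_mem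
      ⟨r₁, h₁, le_rfl, ht.1⟩
    have hR := (hcpt.inter_right (isClosed_Icc (a := t) (b := r₂))).sInf_mem
      ⟨r₂, h₂, ht.2, le_rfl⟩
    set x := sSup (minSet ξ h μ ∩ Icc r₁ t) with hxdef
    set y := sInf (minSet ξ h μ ∩ Icc t r₂) with hydef
    have hxt : x < t := lt_of_le_of_ne hL.2.2 fun h => htM (h ▸ hL.1)
    have hty : t < y := lt_of_le_of_ne hR.2.1 fun h => htM (h ▸ hR.1)
    have hI : Icc x y ⊆ Icc r₁ r₂ := Icc_subset_Icc hL.2.1 hR.2.2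
    refine hμ.force_eq_zero_of_gap hf hpos hL.1 hR.1 (hxt.trans hty) ?_
      (fun s hs => hfp s (hI hs)) (hq.subset hI (convex_Icc _ _)) t ⟨hxt.le, hty.le⟩
    rw [disjoint_left]
    intro s hs hsM
    rcases le_total s t with hst | hst
    · exact hs.1.not_ge (le_csSup (bddAbove_Icc.mono inter_subset_right)
        ⟨hsM, hL.2.1.trans hs.1.le, hst⟩)
    · exact hs.2.not_ge (csInf_le (bddBelow_Icc.mono inter_subset_right)
        ⟨hsM, hst, hs.2.le.trans hR.2.2⟩)
  intro t ht
  have htI := Ioo_subset_Icc_self ht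
  rw [← phiVariation_eq_zero_iff (hfp t htI) (phi_pos_of_functional_lt_top hfin (hsub htI).2),
    ← neg_eq_zero, ← (hasDerivAt_force (h := h) hk (hsub htI)).deriv]
  have hev : force (phiVariation ξ μ) h =ᶠ[nhds t] fun _ => 0 := by
    filter_upwards [isOpen_Ioo.mem_nhds ht] with s hs using hforce s (Ioo_subset_Icc_self hs)
  rw [hev.deriv_eq, deriv_const]

/-- A strictly convex function cannot vanish at three points. The zeros of `k` lie strictly between
`x` and `z`, so convexity on the open interval suffices even if minimizers sit at `l` or `u`. -/
theorem IsOptimal.not_three_mem_minSet (hμ : IsOptimal ξ h μ)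
    (hf : ContinuousOn (iteratedDeriv 2 ξ) (Icc (-1) 1)) {l u : ℝ} (hu : u ≤ 1)
    (hfp : ∀ t ∈ Ioo l u, 0 < iteratedDeriv 2 ξ t)
    (hq : StrictConvexOn ℝ (Ioo l u) (invSqrt ξ)) {x y z : ℝ} (hx : x ∈ minSet ξ h μ)
    (hy : y ∈ minSet ξ h μ) (hz : z ∈ minSet ξ h μ) (hlx : l ≤ x) (hxy : x < y) (hyz : y < z)
    (hzu : z ≤ u) : False := by
  have := hμ.1.1
  have hfin := hμ.functional_lt_top hf
  have hk := continuousOn_phiVariation hf hfin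
  obtain ⟨p₁, p₂, p₃, h1, h12, h23, h3, z1, z2, z3⟩ :=
    exists_three_zeros hk hx.1 hy.1 hz.1 hx.2 hy.2 hz.2 hxy hyz
  have hw : StrictConvexOn ℝ (Ioo l u) (invSqrt ξ - phi μ) :=
    hq.sub_concaveOn (concaveOn_phi.subset (subset_univ _) (convex_Ioo _ _))
  have hzero : ∀ p ∈ Ioo l u, phiVariation ξ μ p = 0 → (invSqrt ξ - phi μ) p = 0 :=
    fun p hp h0 => by
      rw [phiVariation_eq_zero_iff (hfp p hp)
        (phi_pos_of_functional_lt_top hfin (hp.2.trans_le hu))] at h0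
      rw [Pi.sub_apply, h0, sub_self]
  have m1 : p₁ ∈ Ioo l u := ⟨hlx.trans_lt h1, by linarith⟩
  have m2 : p₂ ∈ Ioo l u := ⟨by linarith, by linarith⟩
  have m3 : p₃ ∈ Ioo l u := ⟨by linarith, by linarith⟩
  have hseg : p₂ ∈ openSegment ℝ p₁ p₃ := by
    rw [openSegment_eq_Ioo (h12.trans h23)]; exact ⟨h12, h23⟩
  have := hw.lt_on_openSegment m1 m3 (h12.trans h23).ne hseg
  rw [hzero _ m1 z1, hzero _ m2 z2, hzero _ m3 z3, max_self] at this
  exact lt_irrefl _ this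

/-! ### From `φ_μ = 1/√ξ''` to the density, and the form of `μ` on one component. -/

/-- `-μ([0,s])` is always a supergradient of the concave `φ_μ` at `s`; where a derivative exists, it
must be that number. -/
theorem measureReal_Icc_eq_of_hasDerivAt_phi [IsFiniteMeasure μ] {s d : ℝ}
    (hd : HasDerivAt (phi μ) d s) : μ.real (Icc 0 s) = -d := by
  have hmax : IsLocalMax (fun t => phi μ t + μ.real (Icc 0 s) * t) s := by
    refine Filter.Eventually.of_forall fun t => ?_
    rcases le_total s t with hst | hst
    · have := measureReal_Icc_mul_le_phi_sub (μ := μ) hst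
      simp only
      linarith
    · have := phi_sub_le_measureReal_Icc_mul (μ := μ) hst
      simp only
      linarith
  have := hmax.hasDerivAt_eq_zero (hd.add ((hasDerivAt_id s).const_mul (μ.real (Icc 0 s))))
  linarith

theorem hasDerivAt_deriv_invSqrt {t : ℝ} (hq : AnalyticAt ℝ (invSqrt ξ) t) :
    HasDerivAt (deriv (invSqrt ξ)) (dfun ξ t) t := by
  have : dfun ξ t = deriv (deriv (invSqrt ξ)) t := by
    change iteratedDeriv 2 (invSqrt ξ) t = _
    rw [iteratedDeriv_succ, iteratedDeriv_one]
  rw [this]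
  exact hq.deriv.differentiableAt.hasDerivAt

theorem continuousAt_dfun {t : ℝ} (hq : AnalyticAt ℝ (invSqrt ξ) t) :
    ContinuousAt (dfun ξ) t := by
  have : dfun ξ = deriv (deriv (invSqrt ξ)) := by
    change iteratedDeriv 2 (invSqrt ξ) = _
    rw [iteratedDeriv_succ, iteratedDeriv_one]
  rw [this]
  exact hq.deriv.deriv.continuousAt

/-- Differentiating `φ_μ = q` gives `μ([0,s]) = -q'(s)`, so `(s,t]` has mass `∫ -q''`. Half-open
intervals with rational ends exhaust the open interval, which avoids any regularity at `r₁` and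
`r₂`. -/
theorem restrict_Ioo_eq_withDensity [IsFiniteMeasure μ] {r₁ r₂ : ℝ} (h0 : 0 ≤ r₁)
    (hq : ∀ t ∈ Ioo r₁ r₂, AnalyticAt ℝ (invSqrt ξ) t) (hd : ∀ t ∈ Ioo r₁ r₂, dfun ξ t ≤ 0)
    (hphi : ∀ t ∈ Ioo r₁ r₂, phi μ t = invSqrt ξ t) :
    μ.restrict (Ioo r₁ r₂) = (volume.restrict (Icc r₁ r₂)).withDensity
      (fun s => ENNReal.ofReal (-dfun ξ s)) := by
  have hm : ∀ s ∈ Ioo r₁ r₂, μ.real (Icc 0 s) = -deriv (invSqrt ξ) s := fun s hs => by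
    refine measureReal_Icc_eq_of_hasDerivAt_phi ?_
    refine (hq s hs).differentiableAt.hasDerivAt.congr_of_eventuallyEq ?_
    filter_upwards [isOpen_Ioo.mem_nhds hs] with t ht using hphi t ht
  have hIoc : ∀ s t, r₁ < s → s ≤ t → t < r₂ →
      μ (Ioc s t) = ∫⁻ x in Ioc s t, ENNReal.ofReal (-dfun ξ x) := by
    intro s t hs hst ht
    have hsub : Icc s t ⊆ Ioo r₁ r₂ := fun x hx => ⟨hs.trans_le hx.1, hx.2.trans_lt ht⟩
    have hcont : ContinuousOn (fun x => -dfun ξ x) (Icc s t) := fun x hx =>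
      (continuousAt_dfun (hq x (hsub hx))).neg.continuousWithinAt
    have hdiff : Ioc s t = Icc 0 t \ Icc 0 s := by
      ext x
      simp only [mem_Ioc, mem_sdiff, mem_Icc, not_and, not_le]
      exact ⟨fun hx => ⟨⟨by linarith [hx.1], hx.2⟩, fun _ => hx.1⟩,
        fun hx => ⟨hx.2 hx.1.1, hx.1.2⟩⟩
    have hreal : μ.real (Ioc s t) = ∫ x in s..t, -dfun ξ x := by
      rw [hdiff, measureReal_sdiff (Icc_subset_Icc_right hst) measurableSet_Icc,
        hm s (hsub (left_mem_Icc.2 hst)), hm t (hsub (right_mem_Icc.2 hst)),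
        intervalIntegral.integral_eq_sub_of_hasDerivAt (f := fun x => -deriv (invSqrt ξ) x)]
      · intro x hx
        rw [uIcc_of_le hst] at hx
        exact (hasDerivAt_deriv_invSqrt (hq x (hsub hx))).neg
      · exact hcont.intervalIntegrable_of_Icc hst
    rw [← ofReal_measureReal (measure_ne_top _ _), hreal, intervalIntegral.integral_of_le hst,
      ofReal_integral_eq_lintegral_ofReal (hcont.integrableOn_Icc.mono_set Ioc_subset_Icc_self)]
    filter_upwards [ae_restrict_mem measurableSet_Ioc] with x hx
    exact neg_nonneg.2 (hd x (hsub (Ioc_subset_Icc_self hx)))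
  rw [Measure.restrict_congr_set (Ioo_ae_eq_Icc (a := r₁) (b := r₂)).symm,
    ← restrict_withDensity measurableSet_Ioo]
  have hU : Ioo r₁ r₂ = ⋃ p : {p : ℚ × ℚ // r₁ < p.1 ∧ (p.2 : ℝ) < r₂}, Ioc (p.1.1 : ℝ) p.1.2 := by
    ext x
    simp only [mem_iUnion, mem_Ioc, Subtype.exists, Prod.exists]
    constructor
    · intro hx
      obtain ⟨a, ha1, ha2⟩ := exists_rat_btwn hx.1
      obtain ⟨b, hb1, hb2⟩ := exists_rat_btwn hx.2
      exact ⟨a, b, ⟨ha1, hb2⟩, ha2, hb1.le⟩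
    · rintro ⟨a, b, ⟨ha, hb⟩, hx⟩
      exact ⟨ha.trans hx.1, hx.2.trans_lt hb⟩
  rw [hU, Measure.restrict_iUnion_congr]
  rintro ⟨⟨a, b⟩, ha, hb⟩
  refine Measure.ext_of_Ioc _ _ fun x y _ => ?_
  rw [Measure.restrict_apply measurableSet_Ioc, Measure.restrict_apply measurableSet_Ioc,
    Ioc_inter_Ioc, withDensity_apply _ measurableSet_Ioc]
  rcases le_or_gt (x ⊔ (a : ℝ)) (y ⊓ (b : ℝ)) with hle | hlt
  · exact hIoc _ _ (lt_of_lt_of_le ha le_sup_right) hle (lt_of_le_of_lt inf_le_right hb)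
  · rw [Ioc_eq_empty hlt.le.not_gt]
    simp

/-- The form of an optimal measure on an interval where `𝔡 ≤ 0`. -/
theorem IsOptimal.exists_restrict_eq_nonposPart (hμ : IsOptimal ξ h μ)
    (hf : ContinuousOn (iteratedDeriv 2 ξ) (Icc (-1) 1))
    (hpos : ∀ t ∈ Icc (0 : ℝ) 1, 0 ≤ iteratedDeriv 2 ξ t) {l u : ℝ} (hl : 0 ≤ l)
    (hlu : l ≤ u) (hfp : ∀ t ∈ Icc l u, 0 < iteratedDeriv 2 ξ t)
    (hq : ∀ t ∈ Icc l u, AnalyticAt ℝ (invSqrt ξ) t) (hd : ∀ t ∈ Icc l u, dfun ξ t ≤ 0) :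
    ∃ (r₁ r₂ : ℝ) (n₁ n₂ : ℝ≥0), r₁ ∈ Icc l u ∧ r₂ ∈ Icc l u ∧ r₁ ≤ r₂ ∧
      μ.restrict (Icc l u) = nonposPart ξ r₁ r₂ n₁ n₂ := by
  have := hμ.1.1
  have hcompl := hμ.measure_compl_minSet hf hpos
  have hconc : ConcaveOn ℝ (Icc l u) (invSqrt ξ) := by
    refine concaveOn_of_deriv2_nonpos' (convex_Icc l u)
      (fun t ht => (hq t ht).differentiableAt.differentiableWithinAt)
      (fun t ht => (hq t ht).deriv.differentiableAt.differentiableWithinAt) fun t ht => ?_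
    rw [← iteratedDeriv_eq_iterate]
    exact hd t ht
  rcases (minSet ξ h μ ∩ Icc l u).eq_empty_or_nonempty with hempty | hne
  -- Without minimizers the component is null: zero weights and a degenerate interval represent the
  -- zero measure.
  · refine ⟨l, l, 0, 0, ⟨le_rfl, hlu⟩, ⟨le_rfl, hlu⟩, le_rfl, ?_⟩
    have h0 : μ (Icc l u) = 0 := measure_mono_null
      (fun x hx hxM => (eq_empty_iff_forall_notMem.1 hempty x) ⟨hxM, hx⟩) hcompl
    rw [Measure.restrict_eq_zero.2 h0, nonposPart]
    have : volume.restrict (Icc l l) = 0 := Measure.restrict_eq_zero.2 (by simp)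
    rw [this]
    simp
  have hcpt := (hμ.isCompact_minSet hf hpos).inter_right (isClosed_Icc (a := l) (b := u))
  have h1 := hcpt.sInf_mem hne
  have h2 := hcpt.sSup_mem hne
  -- The extreme minimizers; `μ` has no mass in the component outside `[r₁,r₂]`.
  set r₁ := sInf (minSet ξ h μ ∩ Icc l u) with hr₁
  set r₂ := sSup (minSet ξ h μ ∩ Icc l u) with hr₂
  have hle : r₁ ≤ r₂ := csInf_le hcpt.bddBelow h2
  have hI : Icc r₁ r₂ ⊆ Icc l u := Icc_subset_Icc h1.2.1 h2.2.2
  have hrestr : μ.restrict (Icc l u) = μ.restrict (Icc r₁ r₂) := by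
    refine Measure.restrict_congr_set ?_
    have : ∀ᵐ z ∂μ, z ∈ minSet ξ h μ := by rw [ae_iff]; exact hcompl
    filter_upwards [this] with z hz
    exact propext ⟨fun hzI => ⟨csInf_le hcpt.bddBelow ⟨hz, hzI⟩, le_csSup hcpt.bddAbove ⟨hz, hzI⟩⟩,
      fun hzI => hI hzI⟩
  have hdens : μ.restrict (Ioo r₁ r₂) = (volume.restrict (Icc r₁ r₂)).withDensity
      (fun s => ENNReal.ofReal (-dfun ξ s)) :=
    restrict_Ioo_eq_withDensity (hl.trans h1.2.1)
      (fun t ht => hq t (hI (Ioo_subset_Icc_self ht)))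
      (fun t ht => hd t (hI (Ioo_subset_Icc_self ht)))
      (hμ.phi_eq_invSqrt hf hpos h1.1 h2.1 (fun t ht => hfp t (hI ht))
        (hconc.subset hI (convex_Icc _ _)))
  have hsingle : ∀ x : ℝ, μ.restrict {x} = (μ {x}).toNNReal • Measure.dirac x := fun x => by
    rw [Measure.restrict_singleton]
    ext s _
    simp [ENNReal.smul_def]
  rcases hle.eq_or_lt with heq | hlt
  -- When the two points coincide, the second weight is `0` so that the atom is counted once.
  · refine ⟨r₁, r₂, (μ {r₁}).toNNReal, 0, h1.2, h2.2, hle, ?_⟩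
    rw [hrestr, nonposPart, ← hdens, ← heq, Ioo_self, Icc_self, hsingle]
    simp
  · refine ⟨r₁, r₂, (μ {r₁}).toNNReal, (μ {r₂}).toNNReal, h1.2, h2.2, hle, ?_⟩
    rw [hrestr, nonposPart, ← hdens, ← hsingle, ← hsingle, ← Ioc_insert_left hle,
      ← Ioo_insert_right hlt, insert_eq, insert_eq, Measure.restrict_union,
      Measure.restrict_union]
    · abel
    · simp
    · exact measurableSet_Ioo
    · rw [disjoint_singleton_left]
      rintro (h | h)
      · exact hlt.ne h
      · exact lt_irrefl _ h.1
    · exact (measurableSet_singleton _).union measurableSet_Ioo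

/-- An optimal measure has at most two atoms, and nothing else, in the closure of an interval where
`𝔡 > 0`. -/
theorem IsOptimal.exists_measure_Icc_diff_pair_eq_zero (hμ : IsOptimal ξ h μ)
    (hf : ContinuousOn (iteratedDeriv 2 ξ) (Icc (-1) 1))
    (hpos : ∀ t ∈ Icc (0 : ℝ) 1, 0 ≤ iteratedDeriv 2 ξ t) {l u : ℝ} (hu : u ≤ 1)
    (hlu : l ≤ u) (hfp : ∀ t ∈ Ioo l u, 0 < iteratedDeriv 2 ξ t)
    (hq : ∀ t ∈ Ioo l u, AnalyticAt ℝ (invSqrt ξ) t) (hd : ∀ t ∈ Ioo l u, 0 < dfun ξ t) :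
    ∃ q₁ q₂ : ℝ, q₁ ∈ Icc l u ∧ q₂ ∈ Icc l u ∧ μ (Icc l u \ {q₁, q₂}) = 0 := by
  have hcompl := hμ.measure_compl_minSet hf hpos
  have hconv : StrictConvexOn ℝ (Ioo l u) (invSqrt ξ) := by
    refine strictConvexOn_of_deriv2_pos' (convex_Ioo l u)
      (fun t ht => (hq t ht).continuousAt.continuousWithinAt) fun t ht => ?_
    rw [← iteratedDeriv_eq_iterate]
    exact hd t ht
  suffices h : ∃ q₁ q₂ : ℝ, q₁ ∈ Icc l u ∧ q₂ ∈ Icc l u ∧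
      ∀ z ∈ minSet ξ h μ ∩ Icc l u, z = q₁ ∨ z = q₂ by
    obtain ⟨q₁, q₂, h1, h2, h3⟩ := h
    exact ⟨q₁, q₂, h1, h2, measure_mono_null (fun z hz hzM => hz.2 (h3 z ⟨hzM, hz.1⟩)) hcompl⟩
  rcases (minSet ξ h μ ∩ Icc l u).eq_empty_or_nonempty with hempty | hne
  · exact ⟨l, l, ⟨le_rfl, hlu⟩, ⟨le_rfl, hlu⟩, fun z hz => by simp [hempty] at hz⟩
  have hcpt := (hμ.isCompact_minSet hf hpos).inter_right (isClosed_Icc (a := l) (b := u))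
  have h1 := hcpt.sInf_mem hne
  have h2 := hcpt.sSup_mem hne
  -- The points are the least and greatest minimizers; another one would lie strictly between them.
  refine ⟨_, _, h1.2, h2.2, fun z hz => ?_⟩
  by_contra hcon
  push Not at hcon
  exact hμ.not_three_mem_minSet hf hu hfp hconv h1.1 hz.1 h2.1 h1.2.1
    (lt_of_le_of_ne (csInf_le hcpt.bddBelow hz) hcon.1.symm)
    (lt_of_le_of_ne (le_csSup hcpt.bddAbove hz) hcon.2) h2.2.2

/-! ### Components of subsets of the line. -/

section Components

/-- If `s` were interior to `S`, an interval around it could be joined to the component, which would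
then pass beyond `s`. -/
theorem isLUB_connectedComponentIn_mem_frontier {S : Set ℝ} {x s : ℝ} (hx : x ∈ S)
    (hs : IsLUB (connectedComponentIn S x) s) : s ∈ frontier S := by
  have hxC := mem_connectedComponentIn hx
  have hcl : s ∈ closure (connectedComponentIn S x) := hs.mem_closure ⟨x, hxC⟩
  refine ⟨closure_mono (connectedComponentIn_subset S x) hcl, fun hint => ?_⟩
  obtain ⟨δ, hδ, hball⟩ := Metric.mem_nhds_iff.1 (mem_interior_iff_mem_nhds.1 hint)
  rw [Real.ball_eq_Ioo] at hball
  obtain ⟨y, hy1, hy2⟩ := mem_closure_iff.1 hcl (Ioo (s - δ) (s + δ)) isOpen_Ioo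
    ⟨by linarith, by linarith⟩
  have hpre : IsPreconnected (connectedComponentIn S x ∪ Ioo (s - δ) (s + δ)) :=
    isPreconnected_connectedComponentIn.union y hy2 hy1 isPreconnected_Ioo
  have hsub := hpre.subset_connectedComponentIn (Or.inl hxC)
    (union_subset (connectedComponentIn_subset S x) hball)
  have hmem : s + δ / 2 ∈ connectedComponentIn S x :=
    hsub (Or.inr ⟨by linarith, by linarith⟩)
  linarith [hs.1 hmem]

theorem connectedComponentIn_eq_of_isLUB {S : Set ℝ} {x y s : ℝ} (hx : x ∈ S) (hy : y ∈ S)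
    (hxy : x ≤ y) (hsx : IsLUB (connectedComponentIn S x) s)
    (hsy : IsLUB (connectedComponentIn S y) s) :
    connectedComponentIn S x = connectedComponentIn S y := by
  have hxC := mem_connectedComponentIn hx
  have hyC := mem_connectedComponentIn hy
  refine connectedComponentIn_eq ?_
  have hys : y ≤ s := hsy.1 hyC
  have hpre : IsPreconnected (insert y (connectedComponentIn S x)) := by
    rcases hys.eq_or_lt with rfl | hlt
    · exact isPreconnected_connectedComponentIn.subset_closure (subset_insert _ _)
        (insert_subset (hsx.mem_closure ⟨x, hxC⟩) subset_closure)
    · obtain ⟨z, hz, hyz, -⟩ := hsx.exists_between hlt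
      rw [insert_eq_of_mem]
      · exact isPreconnected_connectedComponentIn
      · exact isPreconnected_connectedComponentIn.ordConnected.out hxC hz ⟨hxy, hyz.le⟩
  exact hpre.subset_connectedComponentIn (mem_insert_of_mem _ hxC)
    (insert_subset hy (connectedComponentIn_subset S x)) (mem_insert _ _)

/-- A bounded set of reals with finite frontier has finitely many components. -/
theorem finite_components_of_finite_frontier {S : Set ℝ} (hS : Bornology.IsBounded S)
    (hF : (frontier S).Finite) : (connectedComponentIn S '' S).Finite := by
  have hlub : ∀ x ∈ S, IsLUB (connectedComponentIn S x) (sSup (connectedComponentIn S x)) :=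
    fun x hx => isLUB_csSup ⟨x, mem_connectedComponentIn hx⟩
      (hS.bddAbove.mono (connectedComponentIn_subset S x))
  -- The supremum maps components injectively into the frontier.
  refine Finite.of_finite_image (f := sSup) (hF.subset ?_) ?_
  · rintro _ ⟨_, ⟨x, hx, rfl⟩, rfl⟩
    exact isLUB_connectedComponentIn_mem_frontier hx (hlub x hx)
  · rintro _ ⟨x, hx, rfl⟩ _ ⟨y, hy, rfl⟩ heq
    have h1 := hlub x hx
    have h2 := hlub y hy
    rw [← heq] at h2
    rcases le_total x y with h | h
    · exact connectedComponentIn_eq_of_isLUB hx hy h h1 h2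
    · exact (connectedComponentIn_eq_of_isLUB hy hx h h2 h1).symm

theorem exists_enumeratesComponents {S : Set ℝ} (hS : (connectedComponentIn S '' S).Finite) :
    ∃ (N : ℕ) (I : Fin N → Set ℝ), EnumeratesComponents S I := by
  have : Finite (connectedComponentIn S '' S) := hS
  refine ⟨_, fun i => ((Finite.equivFin (connectedComponentIn S '' S)).symm i).1,
    fun i j hij => (Equiv.injective _) (Subtype.ext hij), ?_⟩
  rw [range_comp' Subtype.val, Equiv.range_eq_univ, image_univ, Subtype.range_coe]

theorem connectedComponentIn_eq_Icc {S : Set ℝ} (hS : IsCompact S) {x : ℝ} (hx : x ∈ S) :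
    ∃ l u, l ≤ u ∧ connectedComponentIn S x = Icc l u := by
  have hconn := isConnected_connectedComponentIn_iff.2 hx
  have hclosed : IsClosed (connectedComponentIn S x) := by
    refine isClosed_of_closure_subset ?_
    exact (isPreconnected_connectedComponentIn.closure).subset_connectedComponentIn
      (subset_closure (mem_connectedComponentIn hx))
      (closure_minimal (connectedComponentIn_subset S x) hS.isClosed)
  have hcpt := hS.of_isClosed_subset hclosed (connectedComponentIn_subset S x)
  refine ⟨_, _, ?_, eq_Icc_of_connected_compact hconn hcpt⟩
  exact csInf_le_csSup hconn.nonempty hcpt.bddBelow hcpt.bddAbove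

theorem connectedComponentIn_between {S : Set ℝ} (hS : S ⊆ Icc 0 1)
    (hopen : ∀ t ∈ S, S ∈ nhdsWithin t (Icc 0 1)) {x : ℝ} (hx : x ∈ S) :
    ∃ l u, l < u ∧ Ioo l u ⊆ connectedComponentIn S x ∧ connectedComponentIn S x ⊆ Icc l u := by
  have hconn := isConnected_connectedComponentIn_iff.2 hx
  have hsub := (connectedComponentIn_subset S x).trans hS
  have hb : BddBelow (connectedComponentIn S x) := bddBelow_Icc.mono hsub
  have ha : BddAbove (connectedComponentIn S x) := bddAbove_Icc.mono hsub
  refine ⟨_, _, ?_, hconn.Ioo_csInf_csSup_subset hb ha, subset_Icc_csInf_csSup hb ha⟩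
  obtain ⟨δ, hδ, hball⟩ := Metric.mem_nhdsWithin_iff.1 (hopen x hx)
  rw [Real.ball_eq_Ioo] at hball
  have hx01 := hS hx
  have hpre : IsPreconnected (Ioo (x - δ) (x + δ) ∩ Icc 0 1) :=
    (ordConnected_Ioo.inter ordConnected_Icc).isPreconnected
  have hC := hpre.subset_connectedComponentIn ⟨⟨by linarith, by linarith⟩, hx01⟩ hball
  have hxC := mem_connectedComponentIn hx
  -- Relative openness supplies a second point of the component: to the right of `x`, or to the left
  -- if `x = 1`.
  rcases lt_or_ge x 1 with h1 | h1
  · have hy : min (x + δ / 2) 1 ∈ connectedComponentIn S x :=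
      hC ⟨⟨lt_min (by linarith) (by linarith), (min_le_left _ _).trans_lt (by linarith)⟩,
        le_min (by linarith [hx01.1]) zero_le_one, min_le_right _ _⟩
    exact (csInf_le hb hxC).trans_lt ((lt_min (by linarith) h1).trans_le (le_csSup ha hy))
  · have hy : max (x - δ / 2) 0 ∈ connectedComponentIn S x :=
      hC ⟨⟨lt_max_of_lt_left (by linarith), max_lt (by linarith) (by linarith)⟩,
        le_max_right _ _, max_le (by linarith [hx01.2]) zero_le_one⟩
    exact (csInf_le hb hy).trans_lt ((max_lt (by linarith) (by linarith)).trans_le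
      (le_csSup ha hxC))

end Components

/-! ### The sign of `𝔡` and finiteness of the components. -/

section Sign

/-- The numerator of `𝔡`, analytic even where `ξ''` vanishes. -/
noncomputable def dnum (ξ : ℝ → ℝ) (t : ℝ) : ℝ :=
  3 * deriv (iteratedDeriv 2 ξ) t ^ 2 -
    2 * iteratedDeriv 2 ξ t * deriv (deriv (iteratedDeriv 2 ξ)) t

theorem analyticAt_invSqrt {t : ℝ} (hf : AnalyticAt ℝ (iteratedDeriv 2 ξ) t)
    (hp : 0 < iteratedDeriv 2 ξ t) : AnalyticAt ℝ (invSqrt ξ) t := by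
  have h1 : AnalyticAt ℝ (fun x => Real.exp (-(1 / 2) * Real.log (iteratedDeriv 2 ξ x))) t :=
    (analyticAt_const.mul (hf.log hp)).rexp'
  refine h1.congr ?_
  filter_upwards [hf.continuousAt.eventually (lt_mem_nhds hp)] with x hx
  rw [invSqrt, one_div (√_), Real.sqrt_eq_rpow, ← Real.rpow_neg hx.le, Real.rpow_def_of_pos hx, mul_comm]

/-- Differentiating `f^(-1/2)` twice gives `(3f'² - 2ff'')/(4f^(5/2))`; the sign passes to a
function that stays analytic where `f = ξ''` vanishes. -/
theorem dfun_eq_dnum {t : ℝ} (hf : AnalyticAt ℝ (iteratedDeriv 2 ξ) t)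
    (hp : 0 < iteratedDeriv 2 ξ t) :
    dfun ξ t = dnum ξ t / (4 * iteratedDeriv 2 ξ t ^ 2 * √(iteratedDeriv 2 ξ t)) := by
  have hq' : ∀ {x}, AnalyticAt ℝ (iteratedDeriv 2 ξ) x → 0 < iteratedDeriv 2 ξ x →
      HasDerivAt (invSqrt ξ) (-(deriv (iteratedDeriv 2 ξ) x /
        (2 * (iteratedDeriv 2 ξ x * √(iteratedDeriv 2 ξ x))))) x := by
    intro x hfx hpx
    have hs := Real.sqrt_pos.2 hpx
    have h1 := ((hfx.differentiableAt.hasDerivAt.sqrt hpx.ne').inv hs.ne')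
    have h2 : invSqrt ξ = (fun y => √(iteratedDeriv 2 ξ y))⁻¹ := by
      ext y; simp [invSqrt]
    rw [h2]
    refine h1.congr_deriv ?_
    rw [Real.sq_sqrt hpx.le]
    field_simp
  have hev : deriv (invSqrt ξ) =ᶠ[nhds t] fun x => -(deriv (iteratedDeriv 2 ξ) x /
        (2 * (iteratedDeriv 2 ξ x * √(iteratedDeriv 2 ξ x)))) := by
    filter_upwards [hf.continuousAt.eventually (lt_mem_nhds hp),
      hf.eventually_analyticAt] with x hx hfx
    exact (hq' hfx hx).deriv
  have hs := Real.sqrt_pos.2 hp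
  have hf1 := hf.differentiableAt.hasDerivAt
  have hf2 := hf.deriv.differentiableAt.hasDerivAt
  have hd := (hf2.div ((hf1.mul (hf1.sqrt hp.ne')).const_mul 2)
    (mul_pos two_pos (mul_pos hp hs)).ne').neg
  rw [← (hasDerivAt_deriv_invSqrt (analyticAt_invSqrt hf hp)).deriv, hev.deriv_eq]
  refine hd.deriv.trans ?_
  rw [dnum]
  simp only [Pi.mul_apply]
  set s := √(iteratedDeriv 2 ξ t) with hsdef
  have hsq : iteratedDeriv 2 ξ t = s ^ 2 := (Real.sq_sqrt hp.le).symm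
  rw [hsq]
  field_simp
  ring

theorem dfun_pos_iff {t : ℝ} (hf : AnalyticAt ℝ (iteratedDeriv 2 ξ) t)
    (hp : 0 < iteratedDeriv 2 ξ t) : 0 < dfun ξ t ↔ 0 < dnum ξ t := by
  rw [dfun_eq_dnum hf hp]
  have := Real.sqrt_pos.2 hp
  exact div_pos_iff_of_pos_right (by positivity)

theorem analyticAt_dnum {t : ℝ} (hf : AnalyticAt ℝ (iteratedDeriv 2 ξ) t) :
    AnalyticAt ℝ (dnum ξ) t :=
  (analyticAt_const.mul (hf.deriv.pow 2)).sub ((analyticAt_const.mul hf).mul hf.deriv.deriv)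

/-- A function concave on `(0,δ)` does not tend to infinity at `0`. -/
theorem not_concaveOn_of_tendsto_atTop {q : ℝ → ℝ} {δ : ℝ} (hδ : 0 < δ)
    (hq : Filter.Tendsto q (nhdsWithin 0 (Ioi 0)) Filter.atTop) : ¬ConcaveOn ℝ (Ioo 0 δ) q := by
  intro hc
  set a := δ / 3 with ha
  set b := 2 * δ / 3 with hb
  -- With this threshold `q` drops by more than `|q a| + |q b|` on `[s,a]`, which is no longer than
  -- `[a,b]`; its slope is then below that on `[a,b]`, against concavity.
  have hev := (hq.eventually_ge_atTop (2 * |q a| + |q b| + 1)).and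
    (Ioo_mem_nhdsGT (show (0 : ℝ) < a by positivity))
  obtain ⟨s, hs, hs0, hsa⟩ := hev.exists
  have hab : a < b := by rw [ha, hb]; linarith
  have hslope := hc.slope_anti_adjacent (x := s) (y := a) (z := b) ⟨hs0, by linarith⟩
    ⟨by positivity, by linarith⟩ hsa hab
  rw [div_le_div_iff₀ (by linarith) (by linarith)] at hslope
  have h1 : a - s ≤ b - a := by rw [hb, ha]; linarith
  have h2 : 0 < a - s := by linarith
  have h3 := le_abs_self (q a)
  have h4 := neg_abs_le (q b)
  have h5 : q a - q s ≤ -(|q a| + |q b| + 1) := by linarith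
  have h6 : -(|q a| + |q b|) ≤ q b - q a := by linarith
  have h7 := abs_nonneg (q a)
  have h8 := abs_nonneg (q b)
  nlinarith

variable {R : ℝ}

theorem tendsto_invSqrt_atTop (hf0 : iteratedDeriv 2 ξ 0 = 0)
    (hc : ContinuousAt (iteratedDeriv 2 ξ) 0) (hp : ∀ t ∈ Ioc (0 : ℝ) 1, 0 < iteratedDeriv 2 ξ t) :
    Filter.Tendsto (invSqrt ξ) (nhdsWithin 0 (Ioi 0)) Filter.atTop := by
  have h1 : Filter.Tendsto (fun t => √(iteratedDeriv 2 ξ t)) (nhdsWithin 0 (Ioi 0))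
      (nhdsWithin 0 (Ioi 0)) := by
    refine tendsto_nhdsWithin_iff.2 ⟨?_, ?_⟩
    · have := (Real.continuous_sqrt.continuousAt.comp hc).tendsto
      simp only [Function.comp_apply, hf0, Real.sqrt_zero] at this
      exact this.mono_left nhdsWithin_le_nhds
    · filter_upwards [Ioc_mem_nhdsGT one_pos] with t ht using Real.sqrt_pos.2 (hp t ht)
  refine h1.inv_tendsto_nhdsGT_zero.congr fun t => ?_
  simp [invSqrt]

/-- A nonpositive numerator near `0⁺` would make `1/√ξ''` concave there, although it tends to
infinity. By analyticity the numerator is zero near `0`, which this excludes, or has no zero on some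
`(0,u)` and hence one sign. -/
theorem eventually_dnum_pos (hR : 1 < R) (hA : AnalyticOnNhd ℝ (iteratedDeriv 2 ξ) (Ioo (-R) R))
    (hp : ∀ t ∈ Ioc (0 : ℝ) 1, 0 < iteratedDeriv 2 ξ t) (hf0 : iteratedDeriv 2 ξ 0 = 0) :
    ∀ᶠ t in nhdsWithin 0 (Ioi 0), 0 < dnum ξ t := by
  have h0 : (0 : ℝ) ∈ Ioo (-R) R := ⟨by linarith, by linarith⟩
  have hD : ∀ t ∈ Ioo (0 : ℝ) 1, AnalyticAt ℝ (dnum ξ) t := fun t ht =>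
    analyticAt_dnum (hA t ⟨by linarith [ht.1], by linarith [ht.2]⟩)
  have hnot : ¬∀ᶠ t in nhdsWithin 0 (Ioi 0), dnum ξ t ≤ 0 := by
    intro hev
    obtain ⟨u, hu, hsub⟩ := mem_nhdsGT_iff_exists_Ioo_subset.1
      (Filter.inter_mem hev (Ioo_mem_nhdsGT one_pos))
    have hu0 : 0 < u := hu
    refine not_concaveOn_of_tendsto_atTop hu0
      (tendsto_invSqrt_atTop hf0 (hA 0 h0).continuousAt hp) ?_
    have hfa : ∀ t ∈ Ioo 0 u, AnalyticAt ℝ (iteratedDeriv 2 ξ) t ∧ 0 < iteratedDeriv 2 ξ t :=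
      fun t ht => ⟨hA t ⟨by linarith [ht.1], by linarith [(hsub ht).2.2]⟩,
        hp t ⟨ht.1, (hsub ht).2.2.le⟩⟩
    refine concaveOn_of_deriv2_nonpos' (convex_Ioo 0 u)
      (fun t ht => (analyticAt_invSqrt (hfa t ht).1
        (hfa t ht).2).differentiableAt.differentiableWithinAt)
      (fun t ht => (analyticAt_invSqrt (hfa t ht).1
        (hfa t ht).2).deriv.differentiableAt.differentiableWithinAt) fun t ht => ?_
    rw [← iteratedDeriv_eq_iterate]
    exact not_lt.1 fun h => (hsub ht).1.not_gt ((dfun_pos_iff (hfa t ht).1 (hfa t ht).2).1 h)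
  rcases (analyticAt_dnum (hA 0 h0)).eventually_eq_zero_or_eventually_ne_zero with hz | hne
  · exact absurd ((hz.filter_mono nhdsWithin_le_nhds).mono fun t ht => ht.le) hnot
  · have hne' := hne.filter_mono (nhdsWithin_mono 0 fun t (ht : 0 < t) => ht.ne')
    obtain ⟨u, hu, hsub⟩ := mem_nhdsGT_iff_exists_Ioo_subset.1
      (Filter.inter_mem hne' (Ioo_mem_nhdsGT one_pos))
    have hu0 : 0 < u := hu
    have hcont : ContinuousOn (dnum ξ) (Ioo 0 u) := fun t ht =>
      (hD t (hsub ht).2).continuousAt.continuousWithinAt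
    by_contra hcon
    refine hnot ?_
    have : ∃ t ∈ Ioo 0 u, dnum ξ t ≤ 0 := by
      by_contra hall
      push Not at hall
      exact hcon (by filter_upwards [Ioo_mem_nhdsGT hu0] with t ht using hall t ht)
    obtain ⟨t, ht, ht0⟩ := this
    filter_upwards [Ioo_mem_nhdsGT hu0] with x hx
    by_contra hxp
    push Not at hxp
    obtain ⟨y, hy, hy0⟩ := isPreconnected_Ioo.intermediate_value ht hx hcont ⟨ht0, hxp.le⟩
    exact (hsub hy).1 hy0

/-- Where `ξ'' > 0` this is continuity of `𝔡`. At a zero of `ξ''`, necessarily `0`,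
`eventually_dnum_pos` shows that counting the point as positive keeps the set relatively open. -/
theorem posSet_mem_nhdsWithin (hR : 1 < R)
    (hA : AnalyticOnNhd ℝ (iteratedDeriv 2 ξ) (Ioo (-R) R))
    (hp : ∀ t ∈ Ioc (0 : ℝ) 1, 0 < iteratedDeriv 2 ξ t) (h00 : 0 ≤ iteratedDeriv 2 ξ 0)
    {t : ℝ} (ht : t ∈ posSet ξ) : posSet ξ ∈ nhdsWithin t (Icc 0 1) := by
  have hfa := hA t ⟨by linarith [ht.1.1], by linarith [ht.1.2]⟩
  have hft : 0 ≤ iteratedDeriv 2 ξ t := by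
    rcases ht.1.1.eq_or_lt with h | h
    · rwa [← h]
    · exact (hp t ⟨h, ht.1.2⟩).le
  rcases hft.eq_or_lt with hf0 | hfp
  · have ht0 : t = 0 := by
      by_contra hne
      exact (hp t ⟨lt_of_le_of_ne ht.1.1 (Ne.symm hne), ht.1.2⟩).ne hf0
    subst ht0
    have hev := eventually_dnum_pos hR hA hp hf0.symm
    rw [eventually_nhdsWithin_iff] at hev
    filter_upwards [hev.filter_mono nhdsWithin_le_nhds, self_mem_nhdsWithin] with s hs hs01
    refine ⟨hs01, ?_⟩
    rcases hs01.1.eq_or_lt with h | h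
    · exact Or.inl (h ▸ hf0.symm)
    · exact Or.inr ((dfun_pos_iff (hA s ⟨by linarith, by linarith [hs01.2]⟩)
        (hp s ⟨h, hs01.2⟩)).2 (hs h))
  · have hd : 0 < dfun ξ t := ht.2.resolve_left hfp.ne'
    have hev := (continuousAt_dfun (analyticAt_invSqrt hfa hfp)).eventually (lt_mem_nhds hd)
    filter_upwards [hev.filter_mono nhdsWithin_le_nhds, self_mem_nhdsWithin] with s hs hs01
    exact ⟨hs01, Or.inr hs⟩

theorem nonposSet_eq_diff : nonposSet ξ = Icc 0 1 \ posSet ξ := by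
  ext t
  simp only [nonposSet, posSet, mem_ofPred_eq, mem_sdiff, not_and, not_or, not_lt]
  exact ⟨fun h => ⟨h.1, fun _ => h.2⟩, fun h => ⟨h.1, h.2 h.1⟩⟩

theorem isCompact_nonposSet (hR : 1 < R)
    (hA : AnalyticOnNhd ℝ (iteratedDeriv 2 ξ) (Ioo (-R) R))
    (hp : ∀ t ∈ Ioc (0 : ℝ) 1, 0 < iteratedDeriv 2 ξ t) (h00 : 0 ≤ iteratedDeriv 2 ξ 0) :
    IsCompact (nonposSet ξ) := by
  refine isCompact_Icc.of_isClosed_subset (s := Icc 0 1) ?_ fun t ht => ht.1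
  rw [← isOpen_compl_iff, isOpen_iff_mem_nhds]
  intro t ht
  by_cases ht01 : t ∈ Icc (0 : ℝ) 1
  · have htp : t ∈ posSet ξ := by
      by_contra hcon
      exact ht (nonposSet_eq_diff ▸ ⟨ht01, hcon⟩)
    have := posSet_mem_nhdsWithin hR hA hp h00 htp
    rw [mem_nhdsWithin_iff_eventually] at this
    filter_upwards [this] with s hs hsn
    rw [nonposSet_eq_diff] at hsn
    exact hsn.2 (hs hsn.1)
  · filter_upwards [isClosed_Icc.isOpen_compl.mem_nhds ht01] with s hs hsn using hs hsn.1

/-- Identity theorem. The second alternative does occur, for instance when `ξ` is a multiple of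
`t²`. -/
theorem dnum_zeros (hR : 1 < R) (hA : AnalyticOnNhd ℝ (iteratedDeriv 2 ξ) (Ioo (-R) R)) :
    {t ∈ Icc (0 : ℝ) 1 | dnum ξ t = 0}.Finite ∨ ∀ t ∈ Icc (0 : ℝ) 1, dnum ξ t = 0 := by
  have hsub : Icc (0 : ℝ) 1 ⊆ Ioo (-R) R := fun t ht => ⟨by linarith [ht.1], by linarith [ht.2]⟩
  rw [or_iff_not_imp_left]
  intro hinf t ht
  obtain ⟨z, hz, hacc⟩ := Set.Infinite.exists_accPt_of_subset_isCompact hinf isCompact_Icc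
    (fun t ht => ht.1)
  have hfreq : ∃ᶠ x in nhdsWithin z {z}ᶜ, dnum ξ x = 0 :=
    (accPt_iff_frequently_nhdsNE.1 hacc).mono fun x hx => hx.2
  have hD : AnalyticOnNhd ℝ (dnum ξ) (Ioo (-R) R) := fun t ht => analyticAt_dnum (hA t ht)
  exact hD.eqOn_zero_of_preconnected_of_frequently_eq_zero isPreconnected_Ioo (hsub hz) hfreq
    (hsub ht)

theorem finite_frontier (hR : 1 < R)
    (hA : AnalyticOnNhd ℝ (iteratedDeriv 2 ξ) (Ioo (-R) R))
    (hp : ∀ t ∈ Ioc (0 : ℝ) 1, 0 < iteratedDeriv 2 ξ t) :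
    (frontier (posSet ξ)).Finite ∧ (frontier (nonposSet ξ)).Finite := by
  set E := {t | t ∈ Ioo (0 : ℝ) 1 ∧ ¬∀ᶠ s in nhds t, (0 < dnum ξ s ↔ 0 < dnum ξ t)} with hE
  have hEfin : E.Finite := by
    rcases dnum_zeros hR hA with hfin | hzero
    · refine hfin.subset fun t ht => ⟨Ioo_subset_Icc_self ht.1, ?_⟩
      by_contra hne
      refine ht.2 ?_
      have hc := (analyticAt_dnum (hA t ⟨by linarith [ht.1.1], by linarith [ht.1.2]⟩)).continuousAt
      rcases lt_or_gt_of_ne hne with h | h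
      · filter_upwards [hc.eventually (gt_mem_nhds h)] with s hs
        exact iff_of_false hs.not_gt h.not_gt
      · filter_upwards [hc.eventually (lt_mem_nhds h)] with s hs
        exact iff_of_true hs h
    · convert finite_empty
      rw [eq_empty_iff_forall_notMem]
      refine fun t ht => ht.2 ?_
      filter_upwards [isOpen_Ioo.mem_nhds ht.1] with s hs
      rw [hzero s (Ioo_subset_Icc_self hs), hzero t (Ioo_subset_Icc_self ht.1)]
  have hposiff : ∀ t ∈ Ioo (0 : ℝ) 1, (t ∈ posSet ξ ↔ 0 < dnum ξ t) := fun t ht => by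
    have hft := hp t ⟨ht.1, ht.2.le⟩
    rw [← dfun_pos_iff (hA t ⟨by linarith [ht.1], by linarith [ht.2]⟩) hft]
    exact ⟨fun h => h.2.resolve_left hft.ne', fun h => ⟨Ioo_subset_Icc_self ht, Or.inr h⟩⟩
  have hnoniff : ∀ t ∈ Ioo (0 : ℝ) 1, (t ∈ nonposSet ξ ↔ ¬0 < dnum ξ t) := fun t ht => by
    rw [nonposSet_eq_diff, mem_sdiff, hposiff t ht]
    exact and_iff_right (Ioo_subset_Icc_self ht)
  -- If membership in `S` inside `(0,1)` depends only on whether the numerator is positive, the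
  -- frontier lies in the sign changes and the two ends. This serves both sets.
  have key : ∀ S : Set ℝ, S ⊆ Icc 0 1 →
      (∀ t ∈ Ioo (0 : ℝ) 1, ∀ s ∈ Ioo (0 : ℝ) 1, (0 < dnum ξ s ↔ 0 < dnum ξ t) →
        (s ∈ S ↔ t ∈ S)) → frontier S ⊆ {0, 1} ∪ E := by
    intro S hS hiff t ht
    have htI : t ∈ Icc (0 : ℝ) 1 := closure_minimal hS isClosed_Icc ht.1
    by_contra hcon
    simp only [mem_union, mem_insert_iff, mem_singleton_iff, not_or] at hcon
    have htO : t ∈ Ioo (0 : ℝ) 1 :=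
      ⟨lt_of_le_of_ne htI.1 (Ne.symm hcon.1.1), lt_of_le_of_ne htI.2 hcon.1.2⟩
    have hev : ∀ᶠ s in nhds t, (0 < dnum ξ s ↔ 0 < dnum ξ t) := by
      by_contra h
      exact hcon.2 ⟨htO, h⟩
    have hev2 : ∀ᶠ s in nhds t, (s ∈ S ↔ t ∈ S) := by
      filter_upwards [hev, isOpen_Ioo.mem_nhds htO] with s hs hsO using hiff t htO s hsO hs
    by_cases htS : t ∈ S
    · refine ht.2 (mem_interior_iff_mem_nhds.2 ?_)
      filter_upwards [hev2] with s hs using hs.2 htS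
    · obtain ⟨s, hs1, hs2⟩ := ((mem_closure_iff_frequently.1 ht.1).and_eventually hev2).exists
      exact htS (hs2.1 hs1)
  have hfin : ({0, 1} ∪ E : Set ℝ).Finite := (by simp : ({0, 1} : Set ℝ).Finite).union hEfin
  refine ⟨hfin.subset (key _ (fun t ht => ht.1) fun t ht s hs h => ?_),
    hfin.subset (key _ (fun t ht => ht.1) fun t ht s hs h => ?_)⟩
  · rw [hposiff t ht, hposiff s hs, h]
  · rw [hnoniff t ht, hnoniff s hs, h]

end Sign

/-! ### Assembly over the components. -/

theorem exists_restrict_eq_dirac_add_dirac [IsFiniteMeasure μ] {C : Set ℝ}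
    (hC : MeasurableSet C) {q₁ q₂ : ℝ} (h0 : μ (C \ {q₁, q₂}) = 0) :
    ∃ m₁ m₂ : ℝ≥0, μ.restrict C = m₁ • Measure.dirac q₁ + m₂ • Measure.dirac q₂ := by
  have hsingle : ∀ x : ℝ, (μ.restrict C).restrict {x} =
      (μ.restrict C {x}).toNNReal • Measure.dirac x := fun x => by
    rw [Measure.restrict_singleton]
    ext s _
    simp [ENNReal.smul_def]
  have hself : μ.restrict C = (μ.restrict C).restrict {q₁, q₂} := by
    refine (Measure.restrict_eq_self_of_ae_mem ?_).symm
    rw [ae_iff, Measure.restrict_apply₀' hC.nullMeasurableSet, inter_comm]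
    exact h0
  rcases eq_or_ne q₁ q₂ with rfl | hne
  · refine ⟨(μ.restrict C {q₁}).toNNReal, 0, ?_⟩
    rw [zero_smul, add_zero, ← hsingle, ← pair_eq_singleton]
    exact hself
  · refine ⟨(μ.restrict C {q₁}).toNNReal, (μ.restrict C {q₂}).toNNReal, ?_⟩
    rw [← hsingle, ← hsingle, ← Measure.restrict_union (by simpa using hne)
      (measurableSet_singleton _), singleton_union]
    exact hself

theorem EnumeratesComponents.eq_connectedComponentIn {S : Set ℝ} {N : ℕ} {I : Fin N → Set ℝ}
    (hI : EnumeratesComponents S I) (i : Fin N) : ∃ x ∈ S, I i = connectedComponentIn S x := by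
  have : I i ∈ connectedComponentIn S '' S := hI.2 ▸ mem_range_self i
  obtain ⟨x, hx, h⟩ := this
  exact ⟨x, hx, h.symm⟩

theorem EnumeratesComponents.restrict_eq_sum {S : Set ℝ} {N : ℕ} {I : Fin N → Set ℝ}
    (hI : EnumeratesComponents S I) (μ : Measure ℝ) :
    μ.restrict S = ∑ i, μ.restrict (I i) := by
  have hU : S = ⋃ i, I i := by
    refine Subset.antisymm (fun x hx => ?_) (iUnion_subset fun i => ?_)
    · have : connectedComponentIn S x ∈ range I := hI.2 ▸ mem_image_of_mem _ hx
      obtain ⟨i, hi⟩ := this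
      exact mem_iUnion.2 ⟨i, hi ▸ mem_connectedComponentIn hx⟩
    · obtain ⟨x, -, h⟩ := hI.eq_connectedComponentIn i
      exact h ▸ connectedComponentIn_subset S x
  have hdisj : Pairwise (Function.onFun Disjoint I) := by
    intro i j hij
    obtain ⟨x, -, hx⟩ := hI.eq_connectedComponentIn i
    obtain ⟨y, -, hy⟩ := hI.eq_connectedComponentIn j
    refine disjoint_left.2 fun z hz hz' => hij (hI.1 ?_)
    rw [hx] at hz ⊢
    rw [hy] at hz' ⊢
    rw [connectedComponentIn_eq hz, connectedComponentIn_eq hz']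
  have hmeas : ∀ i, MeasurableSet (I i) := fun i => by
    obtain ⟨x, -, hx⟩ := hI.eq_connectedComponentIn i
    rw [hx]
    exact isPreconnected_connectedComponentIn.ordConnected.measurableSet
  conv_lhs => rw [hU]
  rw [Measure.restrict_iUnion hdisj hmeas, Measure.sum_fintype]

/-- The structure of the optimal measure, for a covariance with analytic second derivative. -/
theorem IsOptimal.structure {R : ℝ} (hμ : IsOptimal ξ h μ)
    (hR : 1 < R) (hA : AnalyticOnNhd ℝ (iteratedDeriv 2 ξ) (Ioo (-R) R))
    (hp : ∀ t ∈ Ioc (0 : ℝ) 1, 0 < iteratedDeriv 2 ξ t) (h00 : 0 ≤ iteratedDeriv 2 ξ 0) :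
    ∃ (Np Nn : ℕ) (I : Fin Np → Set ℝ) (J : Fin Nn → Set ℝ)
      (l u : Fin Np → ℝ) (l' u' : Fin Nn → ℝ),
      EnumeratesComponents (posSet ξ) I ∧ EnumeratesComponents (nonposSet ξ) J ∧
      (∀ i, l i < u i ∧ Ioo (l i) (u i) ⊆ I i ∧ I i ⊆ Icc (l i) (u i)) ∧
      (∀ j, l' j ≤ u' j ∧ J j = Icc (l' j) (u' j)) ∧
      ∃ (q₁ q₂ : Fin Np → ℝ) (m₁ m₂ : Fin Np → ℝ≥0)
        (r₁ r₂ : Fin Nn → ℝ) (n₁ n₂ : Fin Nn → ℝ≥0),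
        (∀ i, q₁ i ∈ Icc (l i) (u i) ∧ q₂ i ∈ Icc (l i) (u i) ∧
          μ (Icc (l i) (u i) \ {q₁ i, q₂ i}) = 0) ∧
        (∀ j, r₁ j ∈ Icc (l' j) (u' j) ∧ r₂ j ∈ Icc (l' j) (u' j) ∧ r₁ j ≤ r₂ j ∧
          μ.restrict (Icc (l' j) (u' j)) = nonposPart ξ (r₁ j) (r₂ j) (n₁ j) (n₂ j)) ∧
        μ = (∑ i, (m₁ i • Measure.dirac (q₁ i) + m₂ i • Measure.dirac (q₂ i)))
          + ∑ j, nonposPart ξ (r₁ j) (r₂ j) (n₁ j) (n₂ j) := by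
  have := hμ.1.1
  have hf : ContinuousOn (iteratedDeriv 2 ξ) (Icc (-1) 1) :=
    hA.continuousOn.mono fun t ht => ⟨by linarith [ht.1], by linarith [ht.2]⟩
  have hpos : ∀ t ∈ Icc (0 : ℝ) 1, 0 ≤ iteratedDeriv 2 ξ t := fun t ht => by
    rcases ht.1.eq_or_lt with h | h
    · rwa [← h]
    · exact (hp t ⟨h, ht.2⟩).le
  have hAt : ∀ t ∈ Icc (0 : ℝ) 1, AnalyticAt ℝ (iteratedDeriv 2 ξ) t := fun t ht =>
    hA t ⟨by linarith [ht.1], by linarith [ht.2]⟩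
  have hbp : posSet ξ ⊆ Icc 0 1 := fun t ht => ht.1
  have hbn : nonposSet ξ ⊆ Icc 0 1 := fun t ht => ht.1
  have hbdd : Bornology.IsBounded (Icc (0 : ℝ) 1) := Metric.isBounded_Icc 0 1
  obtain ⟨hFp, hFn⟩ := finite_frontier hR hA hp
  obtain ⟨Np, I, hI⟩ := exists_enumeratesComponents
    (finite_components_of_finite_frontier (hbdd.subset hbp) hFp)
  obtain ⟨Nn, J, hJ⟩ := exists_enumeratesComponents
    (finite_components_of_finite_frontier (hbdd.subset hbn) hFn)
  have hIlu : ∀ i, ∃ l u, l < u ∧ Ioo l u ⊆ I i ∧ I i ⊆ Icc l u := fun i => by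
    obtain ⟨x, hx, h⟩ := hI.eq_connectedComponentIn i
    rw [h]
    exact connectedComponentIn_between hbp (fun t ht => posSet_mem_nhdsWithin hR hA hp h00 ht) hx
  have hJlu : ∀ j, ∃ l u, l ≤ u ∧ J j = Icc l u := fun j => by
    obtain ⟨x, hx, h⟩ := hJ.eq_connectedComponentIn j
    rw [h]
    exact connectedComponentIn_eq_Icc (isCompact_nonposSet hR hA hp h00) hx
  choose l u hlu using hIlu
  choose l' u' hlu' using hJlu
  have hIsub : ∀ i, I i ⊆ posSet ξ := fun i => by
    obtain ⟨x, -, h⟩ := hI.eq_connectedComponentIn i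
    exact h ▸ connectedComponentIn_subset _ x
  have hJsub : ∀ j, Icc (l' j) (u' j) ⊆ nonposSet ξ := fun j => by
    obtain ⟨x, -, h⟩ := hJ.eq_connectedComponentIn j
    rw [← (hlu' j).2, h]
    exact connectedComponentIn_subset _ x
  have hq : ∀ i, ∃ q₁ q₂ : ℝ, q₁ ∈ Icc (l i) (u i) ∧ q₂ ∈ Icc (l i) (u i) ∧
      μ (Icc (l i) (u i) \ {q₁, q₂}) = 0 := fun i => by
    have hsub : Ioo (l i) (u i) ⊆ posSet ξ := (hlu i).2.1.trans (hIsub i)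
    have hcl : Icc (l i) (u i) ⊆ Icc 0 1 := by
      rw [← closure_Ioo (hlu i).1.ne]
      exact closure_minimal (hsub.trans hbp) isClosed_Icc
    have hl0 := (hcl (left_mem_Icc.2 (hlu i).1.le)).1
    have hfp : ∀ t ∈ Ioo (l i) (u i), 0 < iteratedDeriv 2 ξ t := fun t ht =>
      hp t ⟨hl0.trans_lt ht.1, (hsub ht).1.2⟩
    exact hμ.exists_measure_Icc_diff_pair_eq_zero hf hpos
      (hcl (right_mem_Icc.2 (hlu i).1.le)).2 (hlu i).1.le hfp
      (fun t ht => analyticAt_invSqrt (hAt t (hsub ht).1) (hfp t ht))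
      fun t ht => (hsub ht).2.resolve_left (hfp t ht).ne'
  have hr : ∀ j, ∃ (r₁ r₂ : ℝ) (n₁ n₂ : ℝ≥0), r₁ ∈ Icc (l' j) (u' j) ∧ r₂ ∈ Icc (l' j) (u' j) ∧
      r₁ ≤ r₂ ∧ μ.restrict (Icc (l' j) (u' j)) = nonposPart ξ r₁ r₂ n₁ n₂ := fun j => by
    have hsub := hJsub j
    have hfp : ∀ t ∈ Icc (l' j) (u' j), 0 < iteratedDeriv 2 ξ t := fun t ht =>
      lt_of_le_of_ne (hpos t (hsub ht).1) (hsub ht).2.1.symm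
    exact hμ.exists_restrict_eq_nonposPart hf hpos
      (hsub (left_mem_Icc.2 (hlu' j).1)).1.1 (hlu' j).1 hfp
      (fun t ht => analyticAt_invSqrt (hAt t (hsub ht).1) (hfp t ht)) fun t ht => (hsub ht).2.2
  choose q₁ q₂ hq using hq
  choose r₁ r₂ n₁ n₂ hr using hr
  -- The weights come from the component itself, not its closure, so that an atom at an end point
  -- shared with another component is counted once.
  have hm : ∀ i, ∃ m₁ m₂ : ℝ≥0,
      μ.restrict (I i) = m₁ • Measure.dirac (q₁ i) + m₂ • Measure.dirac (q₂ i) := fun i => by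
    refine exists_restrict_eq_dirac_add_dirac ?_
      (measure_mono_null (sdiff_subset_sdiff_left (hlu i).2.2) (hq i).2.2)
    obtain ⟨x, -, h⟩ := hI.eq_connectedComponentIn i
    rw [h]
    exact isPreconnected_connectedComponentIn.ordConnected.measurableSet
  choose m₁ m₂ hm using hm
  refine ⟨Np, Nn, I, J, l, u, l', u', hI, hJ, hlu, hlu', q₁, q₂, m₁, m₂, r₁, r₂, n₁, n₂, hq, hr, ?_⟩
  have hself : μ.restrict (Icc 0 1) = μ := by
    refine Measure.restrict_eq_self_of_ae_mem ?_
    rw [ae_iff]; exact hμ.1.2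
  have hunion : Icc (0 : ℝ) 1 = posSet ξ ∪ nonposSet ξ := by
    rw [nonposSet_eq_diff, union_sdiff_cancel hbp]
  have hdisj : Disjoint (posSet ξ) (nonposSet ξ) := by
    rw [nonposSet_eq_diff]; exact disjoint_sdiff_right
  calc μ = μ.restrict (posSet ξ) + μ.restrict (nonposSet ξ) := by
        rw [← Measure.restrict_union hdisj
          (isCompact_nonposSet hR hA hp h00).measurableSet, ← hunion, hself]
    _ = _ := by
        rw [hI.restrict_eq_sum, hJ.restrict_eq_sum]
        congr 1
        · exact Finset.sum_congr rfl fun i _ => hm i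
        · exact Finset.sum_congr rfl fun j _ => by rw [(hlu' j).2, (hr j).2.2.2]

end CrisantiSommers

theorem corollary4 (β : ℝ) (b : ℕ → ℝ) (h : ℝ)
    (hβ : β ≠ 0) (hb : ∃ p : ℕ, 2 ≤ p ∧ b p ≠ 0)
    (hξ : ∃ ε : ℝ, 0 < ε ∧ Summable (fun p : ℕ => b (p + 2) ^ 2 * (1 + ε) ^ (p + 2)))
    (hh : 0 ≤ h)
    (μ : Measure ℝ) (hμ : CrisantiSommers.IsOptimal (CrisantiSommers.xi β b) h μ) :
    -- both sets have finitely many components `I i`, `J j`, which are intervals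
    ∃ (Np Nn : ℕ) (I : Fin Np → Set ℝ) (J : Fin Nn → Set ℝ)
      (l u : Fin Np → ℝ) (l' u' : Fin Nn → ℝ),
      CrisantiSommers.EnumeratesComponents
        (CrisantiSommers.posSet (CrisantiSommers.xi β b)) I ∧
      CrisantiSommers.EnumeratesComponents
        (CrisantiSommers.nonposSet (CrisantiSommers.xi β b)) J ∧
      (∀ i, l i < u i ∧ Ioo (l i) (u i) ⊆ I i ∧ I i ⊆ Icc (l i) (u i)) ∧
      (∀ j, l' j ≤ u' j ∧ J j = Icc (l' j) (u' j)) ∧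
      ∃ (q₁ q₂ : Fin Np → ℝ) (m₁ m₂ : Fin Np → ℝ≥0)
        (r₁ r₂ : Fin Nn → ℝ) (n₁ n₂ : Fin Nn → ℝ≥0),
        -- at most two atoms, and nothing else, in the closure of a positive component
        (∀ i, q₁ i ∈ Icc (l i) (u i) ∧ q₂ i ∈ Icc (l i) (u i) ∧
          μ (Icc (l i) (u i) \ {q₁ i, q₂ i}) = 0) ∧
        -- the form of `μ` on a nonpositive component
        (∀ j, r₁ j ∈ Icc (l' j) (u' j) ∧ r₂ j ∈ Icc (l' j) (u' j) ∧ r₁ j ≤ r₂ j ∧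
          μ.restrict (Icc (l' j) (u' j)) =
            CrisantiSommers.nonposPart (CrisantiSommers.xi β b)
              (r₁ j) (r₂ j) (n₁ j) (n₂ j)) ∧
        -- the form of `μ` on the whole of `[0,1]`
        μ = (∑ i, (m₁ i • Measure.dirac (q₁ i) + m₂ i • Measure.dirac (q₂ i)))
          + ∑ j, CrisantiSommers.nonposPart (CrisantiSommers.xi β b)
              (r₁ j) (r₂ j) (n₁ j) (n₂ j) := by
  obtain ⟨ε, hε, hs⟩ := hξ
  have hR : 1 < 1 + ε := by linarith
  have hA : AnalyticOnNhd ℝ (iteratedDeriv 2 (CrisantiSommers.xi β b)) (Ioo (-(1 + ε)) (1 + ε)) := by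
    rw [iteratedDeriv_succ, iteratedDeriv_one]
    exact (CrisantiSommers.xi_analyticOnNhd β (by linarith) hs).deriv.deriv
  have hp : ∀ t ∈ Ioc (0 : ℝ) 1, 0 < iteratedDeriv 2 (CrisantiSommers.xi β b) t := fun t ht =>
    CrisantiSommers.iteratedDeriv_two_xi_pos hβ hb hs ht.1 (ht.2.trans_lt hR)
  refine hμ.structure hR hA hp ?_
  -- `ξ''(0) ≥ 0` is the limit from the right of positive values.
  have hc := (hA 0 ⟨by linarith, by linarith⟩).continuousAt.tendsto.mono_left
    (nhdsWithin_le_nhds (s := Ioi 0))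
  refine ge_of_tendsto hc ?_
  filter_upwards [Ioc_mem_nhdsGT one_pos] with t ht using (hp t ht).le
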